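/- Let $\ell$ be a prime with $\ell-1=2^{\alpha}3^{\beta}m$ for some integers $\alpha>0$, $\beta\ge 0$ and $m$ with $\gcd(m,6)=1$. For an integer $k$ with $1\le k\le \ell-2$ put $$M_{k,\ell}=\{\,j\in(\mathbb Z/\ell\mathbb Z)^* : \langle kj\rangle_\ell+\langle j\rangle_\ell<\ell\,\},\qquad W_{k,\ell}=\{\,w\in(\mathbb Z/\ell\mathbb Z)^* : wM_{k,\ell}=M_{k,\ell}\,\},$$ where $\langle j\rangle_\ell$ denotes the representative of $j$ in $\{1,\dots,\ell-1\}$. Let $E_{k,\ell}(a)=0$ if $a\in M_{k,\ell}$ and $E_{k,\ell}(a)=1$ if $a\in(\mathbb Z/\ell\mathbb Z)^*\setminus M_{k,\ell}$; this depends only on the coset of $a$ modulo the subgroup $W_{k,\ell}$. The Demjanenko matrix is $$D_{k,\ell}=\Bigl(E_{k,\ell}(-c^{-1}a)-\tfrac12\Bigr)_{c,a\in M_{k,\ell}/W_{k,\ell}}.$$ Let $\mathcal K_\ell$ be the set of integers $k\in[1,\ell-2]$ for which $D_{k,\ell}$ is singular. Then $$\left|\#\mathcal K_\ell-\frac{1}{2^{2\alpha+2}}\left(1-\frac{1}{3^{2\beta}}\right)\ell\right|\le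 4\beta^2\sqrt{\ell}+\frac{33}{16}.$$ -/

import Mathlib

open scoped Pointwise

namespace Demjanenko

/-- The set `M_{k,ℓ}` of units `j` modulo `ℓ` with `⟨kj⟩ + ⟨j⟩ < ℓ`, where `⟨·⟩` is the
representative in `{0, …, ℓ - 1}` (nonzero on nonzero classes). -/
def M (ℓ k : ℕ) : Set (ZMod ℓ)ˣ :=
  {j | ((k : ZMod ℓ) * (j : ZMod ℓ)).val + (j : ZMod ℓ).val < ℓ}

/-- The subgroup `W_{k,ℓ}` of all units `w` with `w M_{k,ℓ} = M_{k,ℓ}`. -/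
def W (ℓ k : ℕ) : Subgroup (ZMod ℓ)ˣ :=
  MulAction.stabilizer (ZMod ℓ)ˣ (M ℓ k)

open Classical in
/-- `E_{k,ℓ}(a) = 0` if `a ∈ M_{k,ℓ}` and `1` otherwise. -/
noncomputable def E (ℓ k : ℕ) (a : (ZMod ℓ)ˣ) : ℚ :=
  if a ∈ M ℓ k then 0 else 1

theorem mul_mem_M_iff {ℓ k : ℕ} {w : (ZMod ℓ)ˣ} (hw : w ∈ W ℓ k) (a : (ZMod ℓ)ˣ) :
    w * a ∈ M ℓ k ↔ a ∈ M ℓ k := by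
  have h : w • M ℓ k = M ℓ k := hw
  constructor
  · intro ha
    rw [← h] at ha
    exact Set.smul_mem_smul_set_iff.mp ha
  · intro ha
    rw [← h]
    exact Set.smul_mem_smul_set ha

theorem E_eq_of_rel {ℓ k : ℕ} (a b : (ZMod ℓ)ˣ)
    (h : QuotientGroup.leftRel (W ℓ k) a b) : E ℓ k a = E ℓ k b := by
  rw [QuotientGroup.leftRel_apply] at h
  have h1 := mul_mem_M_iff h a
  have h2 : a⁻¹ * b * a = b := by rw [mul_comm, mul_inv_cancel_left]
  rw [h2] at h1
  unfold E
  by_cases ha : a ∈ M ℓ k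
  · rw [if_pos ha, if_pos (h1.mpr ha)]
  · rw [if_neg ha, if_neg (fun hb => ha (h1.mp hb))]

/-- The function induced by `E_{k,ℓ}` on the cosets of `W_{k,ℓ}`. -/
noncomputable def EQuot (ℓ k : ℕ) : (ZMod ℓ)ˣ ⧸ W ℓ k → ℚ :=
  Quotient.lift (E ℓ k) E_eq_of_rel

/-- `M_{k,ℓ} / W_{k,ℓ}`: the set of cosets of `W_{k,ℓ}` in `M_{k,ℓ}`. -/
abbrev Index (ℓ k : ℕ) : Type :=
  ((QuotientGroup.mk : (ZMod ℓ)ˣ → (ZMod ℓ)ˣ ⧸ W ℓ k) '' M ℓ k : Set ((ZMod ℓ)ˣ ⧸ W ℓ k))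

/-- The Demjanenko matrix `D_{k,ℓ} = (E_{k,ℓ}(-c⁻¹ a) - 1/2)`, indexed by
`c, a ∈ M_{k,ℓ} / W_{k,ℓ}`. -/
noncomputable def D (ℓ k : ℕ) : Matrix (Index ℓ k) (Index ℓ k) ℚ :=
  Matrix.of fun c a =>
    EQuot ℓ k (QuotientGroup.mk (-1) * (c : (ZMod ℓ)ˣ ⧸ W ℓ k)⁻¹ * (a : (ZMod ℓ)ˣ ⧸ W ℓ k)) - 1 / 2

/-- The entries of `D_{k,ℓ}` computed on representatives. -/
theorem D_apply (ℓ k : ℕ) (c a : (ZMod ℓ)ˣ) (hc : c ∈ M ℓ k) (ha : a ∈ M ℓ k) :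
    D ℓ k ⟨QuotientGroup.mk c, c, hc, rfl⟩ ⟨QuotientGroup.mk a, a, ha, rfl⟩ =
      E ℓ k (-c⁻¹ * a) - 1 / 2 := by
  have h : (-c⁻¹ * a : (ZMod ℓ)ˣ) = -1 * c⁻¹ * a := by rw [neg_one_mul]
  rw [h]
  rfl

noncomputable instance (ℓ k : ℕ) [NeZero ℓ] : Fintype (Index ℓ k) :=
  Fintype.ofFinite _

open Classical in
/-- The set `K_ℓ` of the integers `1 ≤ k ≤ ℓ - 2` for which `D_{k,ℓ}` is singular. -/
noncomputable def K (ℓ : ℕ) [NeZero ℓ] : Finset ℕ :=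
  (Finset.Icc 1 (ℓ - 2)).filter fun k => (D ℓ k).det = 0

end Demjanenko

/-! Send `k` to the point `(x, y) = (k, -1 - k)` of the line `1 + x + y = 0` with both coordinates
units. The residues `⟨a⟩ + ⟨xa⟩ + ⟨ya⟩` add up to `ℓ` or `2ℓ` according to `E`, so for odd `χ` the
sum of `χ E` is `(1 + χ⁻¹(x) + χ⁻¹(y)) B / ℓ` with `B = ∑ χ(j)⟨j⟩`. Here `B ≠ 0`, since `-B / ℓ =
L(χ, 0)`, which the functional equation ties to `L(χ⁻¹, 1) ≠ 0`
(`DirichletCharacter.sum_apply_mul_val_ne_zero_of_odd`).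

`D` is the group matrix of an odd function restricted to representatives modulo `-1`, so it is
singular exactly when some odd character trivial on `W` kills `E` (`det_of_odd_eq_zero_iff`), that
is, when `1 + χ(x) + χ(y) = 0`. The group `W` is trivial unless `x² = y`, and in that case `D` is
nonsingular; at most two points are affected.

For roots of unity, `1 + χ(x) + χ(y) = 0` says that `χ(x)`, `χ(y)` are the two primitive cube roots
of unity. In discrete logarithms `a, b` of `x, y` an odd such `χ` exists iff `2^α` divides `a` and
`b`, and for some `s < β`, `3^s` divides `a` exactly and `3^(s+1)` divides `a + b`
(`exists_odd_char_iff`). Jacobi sum bounds equidistribute the line over these congruences: each `s`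
costs at most `2√ℓ`, and the densities form a geometric series with the stated main term. -/

/-! ### Odd Hurwitz zeta at `0` and nonvanishing of `B_{1,χ}`. -/

open Complex in
theorem norm_cpow_taylor_le {s : ℂ} (hs : ‖s‖ ≤ 3) (hre : -(1 / 2) ≤ s.re) {r t : ℝ} (hr : 1 ≤ r)
    (ht : t ∈ Set.Icc r (r + 1)) :
    ‖(t : ℂ) ^ (-s) - (r : ℂ) ^ (-s) + s * (r : ℂ) ^ (-s - 1) * (t - r)‖ ≤
      12 * r ^ (-(3 / 2) : ℝ) := by
  have hd (c : ℂ) (u : ℝ) (hu : u ∈ Set.Icc r (r + 1)) :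
      HasDerivAt (fun y : ℝ => (y : ℂ) ^ c) (c * (u : ℂ) ^ (c - 1)) u := by
    have hu0 : (u : ℂ) ∈ slitPlane := Or.inl (by simpa using by linarith [hu.1])
    simpa using ((hasDerivAt_id (u : ℂ)).cpow_const (c := c) hu0).comp_ofReal
  -- Second derivative bound: `‖s‖ ‖s + 1‖ ≤ 3 · 4`, and `re (-s - 2) ≤ -3/2`. Two applications of
  -- the mean value inequality then give the first-order remainder.
  have hb (u : ℝ) (hu : u ∈ Set.Icc r (r + 1)) :
      ‖-s * ((-s - 1) * (u : ℂ) ^ (-s - 1 - 1))‖ ≤ 12 * r ^ (-(3 / 2) : ℝ) := by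
    have hu0 : 0 < u := by linarith [hu.1]
    rw [norm_mul, norm_mul, norm_neg, norm_cpow_eq_rpow_re_of_pos hu0, ← mul_assoc]
    have h1 : ‖-s - 1‖ ≤ 4 := by
      calc ‖-s - 1‖ ≤ ‖-s‖ + ‖(1 : ℂ)‖ := norm_sub_le _ _
        _ ≤ 4 := by rw [norm_neg, norm_one]; linarith
    have h2 : u ^ (-s - 1 - 1).re ≤ r ^ (-(3 / 2) : ℝ) := by
      calc u ^ (-s - 1 - 1).re ≤ u ^ (-(3 / 2) : ℝ) := by
            apply Real.rpow_le_rpow_of_exponent_le (by linarith [hu.1])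
            simp only [sub_re, neg_re, one_re]; linarith
        _ ≤ r ^ (-(3 / 2) : ℝ) :=
            Real.rpow_le_rpow_of_nonpos (by linarith) hu.1 (by norm_num)
    have h3 : ‖s‖ * ‖-s - 1‖ ≤ 12 := by
      nlinarith [norm_nonneg s, norm_nonneg (-s - 1)]
    gcongr
  have hr' : r ∈ Set.Icc r (r + 1) := ⟨le_rfl, by linarith⟩
  have hle (u : ℝ) (hu : u ∈ Set.Icc r (r + 1)) : ‖u - r‖ ≤ 1 := by
    rw [Real.norm_of_nonneg (by linarith [hu.1])]; linarith [hu.2]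
  have hC : 0 ≤ 12 * r ^ (-(3 / 2) : ℝ) := by positivity
  have h1 (u : ℝ) (hu : u ∈ Set.Icc r (r + 1)) :
      ‖-s * (u : ℂ) ^ (-s - 1) + s * (r : ℂ) ^ (-s - 1)‖ ≤ 12 * r ^ (-(3 / 2) : ℝ) := by
    have := Convex.norm_image_sub_le_of_norm_hasDerivWithin_le
      (fun v hv => ((hd (-s - 1) v hv).const_mul (-s)).hasDerivWithinAt) hb (convex_Icc r (r + 1))
      hr' hu
    rw [neg_mul s ((r : ℂ) ^ _), sub_neg_eq_add] at this
    exact this.trans (mul_le_of_le_one_right hC (hle u hu))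
  have h2 (u : ℝ) (hu : u ∈ Set.Icc r (r + 1)) :
      HasDerivWithinAt (fun y : ℝ => (y : ℂ) ^ (-s) + s * (r : ℂ) ^ (-s - 1) * (y - r))
        (-s * (u : ℂ) ^ (-s - 1) + s * (r : ℂ) ^ (-s - 1)) (Set.Icc r (r + 1)) u := by
    refine HasDerivAt.hasDerivWithinAt ((hd (-s) u hu).add ?_)
    simpa using ((hasDerivAt_id (u : ℂ)).comp_ofReal.sub_const (r : ℂ)).const_mul
      (s * (r : ℂ) ^ (-s - 1))
  have := Convex.norm_image_sub_le_of_norm_hasDerivWithin_le h2 h1 (convex_Icc r (r + 1)) hr' ht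
  have h3 := this.trans (mul_le_of_le_one_right hC (hle t ht))
  rw [sub_self, mul_zero, add_zero, add_sub_right_comm] at h3
  exact h3

/-- The `n`-th term of the convergent series that continues the odd Hurwitz zeta function. -/
noncomputable def oddHurwitzTerm (x : ℝ) (n : ℕ) (s : ℂ) : ℂ :=
  (((n + 1 + x : ℝ) : ℂ) ^ (-s) - ((n + 1 + (1 - x) : ℝ) : ℂ) ^ (-s))
    - (1 - 2 * x) * (((n + 1 : ℝ) : ℂ) ^ (-s) - ((n + 1 + 1 : ℝ) : ℂ) ^ (-s))

/-- Expanding all powers at `n + 1`, the difference of the first two has linear part proportional to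
`1 - 2x`; the subtracted multiple of a telescoping term cancels it. Three remainders of size `12`
are left, and the exponent `-3/2` makes the series converge beyond `s = 0`. -/
theorem norm_oddHurwitzTerm_le {x : ℝ} (hx : x ∈ Set.Ioo 0 1) (n : ℕ) {s : ℂ} (hs : ‖s‖ ≤ 3)
    (hre : -(1 / 2) ≤ s.re) :
    ‖oddHurwitzTerm x n s‖ ≤ 36 * ((n + 1 : ℕ) : ℝ) ^ (-(3 / 2) : ℝ) := by
  have hr : (1 : ℝ) ≤ n + 1 := by linarith [n.cast_nonneg (α := ℝ)]
  have h (y : ℝ) (hy : y ∈ Set.Icc (0 : ℝ) 1) := norm_cpow_taylor_le hs hre hr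
    (t := n + 1 + y) ⟨by linarith [hy.1], by linarith [hy.2]⟩
  have h1 := h x ⟨hx.1.le, hx.2.le⟩
  have h2 := h (1 - x) ⟨by linarith [hx.2], by linarith [hx.1]⟩
  have h3 := h 1 ⟨by norm_num, by norm_num⟩
  have h4 : ‖((1 - 2 * x : ℝ) : ℂ)‖ ≤ 1 := by
    rw [Complex.norm_real, Real.norm_eq_abs, abs_le]
    constructor <;> linarith [hx.1, hx.2]
  set A := (((n + 1 + x : ℝ)) : ℂ) ^ (-s) - ((n + 1 : ℝ) : ℂ) ^ (-s) +
    s * ((n + 1 : ℝ) : ℂ) ^ (-s - 1) * ((n + 1 + x : ℝ) - (n + 1 : ℝ)) with hA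
  set B := (((n + 1 + (1 - x) : ℝ)) : ℂ) ^ (-s) - ((n + 1 : ℝ) : ℂ) ^ (-s) +
    s * ((n + 1 : ℝ) : ℂ) ^ (-s - 1) * ((n + 1 + (1 - x) : ℝ) - (n + 1 : ℝ)) with hB
  set C := (((n + 1 + 1 : ℝ)) : ℂ) ^ (-s) - ((n + 1 : ℝ) : ℂ) ^ (-s) +
    s * ((n + 1 : ℝ) : ℂ) ^ (-s - 1) * ((n + 1 + 1 : ℝ) - (n + 1 : ℝ)) with hC
  have key : oddHurwitzTerm x n s = A - B + ((1 - 2 * x : ℝ) : ℂ) * C := by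
    rw [hA, hB, hC, oddHurwitzTerm]
    push_cast
    ring
  have h5 : ‖((1 - 2 * x : ℝ) : ℂ) * C‖ ≤ 12 * (n + 1 : ℝ) ^ (-(3 / 2) : ℝ) := by
    rw [norm_mul]
    exact (mul_le_of_le_one_left (norm_nonneg _) h4).trans h3
  rw [key]
  have h6 := norm_add_le (A - B) (((1 - 2 * x : ℝ) : ℂ) * C)
  have h7 := norm_sub_le A B
  rw [Nat.cast_add, Nat.cast_one]
  linarith

theorem differentiable_oddHurwitzTerm {x : ℝ} (hx : x ∈ Set.Ioo 0 1) (n : ℕ) :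
    Differentiable ℂ (oddHurwitzTerm x n) := by
  have h (y : ℝ) (hy : 0 < y) : Differentiable ℂ (fun s : ℂ => (y : ℂ) ^ (-s)) :=
    differentiable_neg.const_cpow (Or.inl (by exact_mod_cast hy.ne'))
  have hn : (0 : ℝ) ≤ n := n.cast_nonneg
  exact ((h _ (by linarith [hx.1])).sub (h _ (by linarith [hx.2]))).sub
    (((h _ (by linarith)).sub (h _ (by linarith))).const_mul _)

open HurwitzZeta in
theorem hasSum_oddHurwitzTerm {x : ℝ} (hx : x ∈ Set.Ioo 0 1) {s : ℂ} (hs : 1 < s.re) :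
    HasSum (fun n => oddHurwitzTerm x n s) (2 * hurwitzZetaOdd x s -
      ((x : ℂ) ^ (-s) - ((1 - x : ℝ) : ℂ) ^ (-s) + (1 - 2 * x))) := by
  have h1 := (hasSum_nat_hurwitzZetaOdd_of_mem_Icc (Set.Ioo_subset_Icc_self hx) hs).mul_left 2
  rw [← hasSum_nat_add_iff' 1] at h1
  have hz : HasSum (fun n : ℕ => ((n + 1 : ℝ) : ℂ) ^ (-s)) (riemannZeta s) := by
    rw [zeta_eq_tsum_one_div_nat_add_one_cpow hs]
    have h := (summable_nat_add_iff 1).mpr (Complex.summable_one_div_nat_cpow.mpr hs)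
    have h' := h.hasSum.congr_fun (g := fun n : ℕ => ((n + 1 : ℝ) : ℂ) ^ (-s)) fun n => by
      rw [Complex.cpow_neg]; push_cast; rw [one_div]
    simpa using h'
  have hz1 := hz
  rw [← hasSum_nat_add_iff' 1] at hz1
  have h2 := h1.sub ((hz.sub hz1).mul_left (1 - 2 * (x : ℂ)))
  have hv : 2 * hurwitzZetaOdd x s - ((x : ℂ) ^ (-s) - ((1 - x : ℝ) : ℂ) ^ (-s) + (1 - 2 * x)) =
      2 * hurwitzZetaOdd x s - ∑ i ∈ Finset.range 1,
        2 * ((1 / ((i : ℂ) + x) ^ s - 1 / ((i : ℂ) + 1 - x) ^ s) / 2) - (1 - 2 * (x : ℂ)) *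
          (riemannZeta s - (riemannZeta s - ∑ i ∈ Finset.range 1, ((i + 1 : ℝ) : ℂ) ^ (-s))) := by
    simp only [Complex.cpow_neg, Finset.sum_range_one]
    push_cast
    rw [zero_add, zero_add, Complex.one_cpow]
    ring
  rw [hv]
  refine h2.congr_fun fun n => ?_
  rw [oddHurwitzTerm]
  simp only [Complex.cpow_neg]
  push_cast
  ring_nf

-- The corrected series is analytic on a convex region containing both `2` and `0`, so the identity
-- from `re s > 1` persists to `s = 0`, where every term of the series is zero.
open HurwitzZeta in
theorem hurwitzZetaOdd_apply_zero {x : ℝ} (hx : x ∈ Set.Ioo 0 1) :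
    hurwitzZetaOdd x 0 = 1 / 2 - x := by
  set U : Set ℂ := Metric.ball 0 3 ∩ {s | -(1 / 2) < s.re} with hU
  have hUo : IsOpen U :=
    Metric.isOpen_ball.inter (isOpen_lt continuous_const Complex.continuous_re)
  have hUc : Convex ℝ U := (convex_ball 0 3).inter (convex_halfSpace_re_gt _)
  have hsum : Summable fun n : ℕ => 36 * ((n + 1 : ℕ) : ℝ) ^ (-(3 / 2) : ℝ) :=
    ((summable_nat_add_iff 1).mpr (Real.summable_nat_rpow.mpr (by norm_num))).mul_left 36
  have hT : DifferentiableOn ℂ (fun s => ∑' n, oddHurwitzTerm x n s) U := by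
    refine Complex.differentiableOn_tsum_of_summable_norm hsum
      (fun n => (differentiable_oddHurwitzTerm hx n).differentiableOn) hUo fun n s hs => ?_
    exact norm_oddHurwitzTerm_le hx n (by simpa using (Metric.mem_ball.mp hs.1).le) (le_of_lt hs.2)
  have hp (y : ℝ) (hy : 0 < y) : Differentiable ℂ (fun s : ℂ => (y : ℂ) ^ (-s)) :=
    differentiable_neg.const_cpow (Or.inl (by exact_mod_cast hy.ne'))
  have hG : DifferentiableOn ℂ (fun s => ((x : ℂ) ^ (-s) - ((1 - x : ℝ) : ℂ) ^ (-s) + (1 - 2 * x))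
      + ∑' n, oddHurwitzTerm x n s) U :=
    DifferentiableOn.add ((((hp x hx.1).sub (hp (1 - x) (by linarith [hx.2]))).add_const
      _).differentiableOn) hT
  have hZ : DifferentiableOn ℂ (fun s => 2 * hurwitzZetaOdd x s) U :=
    ((differentiable_hurwitzZetaOdd _).const_mul 2).differentiableOn
  have h2 : (2 : ℂ) ∈ U := ⟨by simp; norm_num, by simp; norm_num⟩
  have h0 : (0 : ℂ) ∈ U := ⟨by simp, by simp⟩
  have hE := (hZ.analyticOnNhd hUo).eqOn_of_preconnected_of_eventuallyEq (hG.analyticOnNhd hUo)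
    hUc.isPreconnected h2 (by
      have : {s : ℂ | 1 < s.re} ∈ nhds (2 : ℂ) :=
        (isOpen_lt continuous_const Complex.continuous_re).mem_nhds (by simp)
      filter_upwards [this] with s hs
      rw [(hasSum_oddHurwitzTerm hx hs).tsum_eq]
      ring) h0
  simp [oddHurwitzTerm] at hE
  linear_combination hE / 2

theorem DirichletCharacter.isPrimitive_of_ne_one_of_prime {p : ℕ} [Fact p.Prime]
    {χ : DirichletCharacter ℂ p} (hχ : χ ≠ 1) : χ.IsPrimitive := by
  rcases (Nat.dvd_prime (Fact.out : p.Prime)).mp χ.conductor_dvd_level with h | h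
  · exact absurd (DirichletCharacter.eq_one_iff_conductor_eq_one.mpr h) hχ
  · exact h

/-- The gamma factor of an odd character is finite and nonzero at `0`, so a zero there would be one
of the completed function, and the functional equation would move it to `L(χ⁻¹, 1)`. -/
theorem DirichletCharacter.LFunction_apply_zero_ne_zero_of_odd {p : ℕ} [Fact p.Prime]
    {χ : DirichletCharacter ℂ p} (hχ : χ.Odd) : LFunction χ 0 ≠ 0 := by
  have hχ1 : χ ≠ 1 := by
    rintro rfl
    have h : ((1 : DirichletCharacter ℂ p) (-1)) = -1 := hχ
    rw [MulChar.one_apply isUnit_one.neg] at h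
    norm_num at h
  have hp1 : p ≠ 1 := (Fact.out : p.Prime).ne_one
  have hinv : χ⁻¹ ≠ 1 := inv_ne_one.mpr hχ1
  have hodd : (χ⁻¹).Odd := by
    have h : χ (-1) = -1 := hχ
    change χ⁻¹ (-1) = -1
    rw [MulChar.inv_apply_eq_inv', h]; norm_num
  intro h0
  have h1 := LFunction_apply_one_ne_zero hinv
  apply h1
  rw [LFunction_eq_completed_div_gammaFactor _ _ (Or.inr hp1)] at h0 ⊢
  have hΓ : χ.gammaFactor 0 ≠ 0 := by
    rw [hχ.gammaFactor_def]
    exact Complex.Gammaℝ_ne_zero_of_re_pos (by simp)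
  have hc : completedLFunction χ 0 = 0 := (div_eq_zero_iff.mp h0).resolve_right hΓ
  have hf := IsPrimitive.completedLFunction_one_sub (isPrimitive_of_ne_one_of_prime hinv) 0
  rw [sub_zero, inv_inv, hc, mul_zero] at hf
  rw [hf, zero_div]

/-- The generalized Bernoulli number `B_{1,χ}` of an odd character does not vanish. -/
theorem DirichletCharacter.sum_apply_mul_val_ne_zero_of_odd {p : ℕ} [Fact p.Prime]
    {χ : DirichletCharacter ℂ p} (hχ : χ.Odd) : ∑ j : ZMod p, χ j * (j.val : ℂ) ≠ 0 := by
  have hodd : Function.Odd (χ : ZMod p → ℂ) := fun x => by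
    have h : χ (-1) = -1 := hχ
    rw [← neg_one_mul, map_mul, h, neg_one_mul]
  have hχ1 : χ ≠ 1 := by
    rintro rfl
    have h : ((1 : DirichletCharacter ℂ p) (-1)) = -1 := hχ
    rw [MulChar.one_apply isUnit_one.neg] at h
    norm_num at h
  intro hB
  apply LFunction_apply_zero_ne_zero_of_odd hχ
  have h1 : ∑ j : ZMod p, χ j * HurwitzZeta.hurwitzZetaOdd (ZMod.toAddCircle j) 0
      = ∑ j : ZMod p, (χ j * (1 / 2) - χ j * (j.val : ℂ) * (1 / p)) := by
    refine Finset.sum_congr rfl fun j _ => ?_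
    by_cases hj : j = 0
    · subst hj
      rw [χ.map_nonunit not_isUnit_zero]; simp
    · have hv : 0 < j.val := by rwa [ZMod.val_pos]
      have hv' : j.val < p := j.val_lt
      rw [ZMod.toAddCircle_apply, hurwitzZetaOdd_apply_zero]
      · push_cast; ring
      · have hp : (0 : ℝ) < p := by exact_mod_cast hv.trans hv'
        refine ⟨by positivity, ?_⟩
        rw [div_lt_one hp]
        exact_mod_cast hv'
  rw [LFunction, ZMod.LFunction_def_odd hodd, h1, Finset.sum_sub_distrib, ← Finset.sum_mul,
    ← Finset.sum_mul, hB, MulChar.sum_eq_zero_of_ne_one hχ1]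
  simp

/-! ### Group determinants of odd functions on a finite abelian group. -/

section FiniteAbelian

variable {Q : Type*} [CommGroup Q] [Fintype Q]

/-- Fourier inversion: weight each coefficient by `ψ(q₀⁻¹)`, sum over `ψ` and use orthogonality. -/
theorem eq_zero_of_forall_sum_mul_char_eq_zero (h : Q → ℂ)
    (H : ∀ χ : Q →* ℂ, ∑ q, h q * χ q = 0) : h = 0 := by
  classical
  funext q₀
  have h1 : ∑ ψ : AddChar (Additive Q) ℂ, ψ (Additive.ofMul q₀⁻¹) *
      ∑ q : Q, h q * ψ (Additive.ofMul q) = 0 := by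
    refine Finset.sum_eq_zero fun ψ _ => ?_
    have := H (AddChar.toMonoidHomEquiv ψ)
    rw [show ∑ q : Q, h q * ψ (Additive.ofMul q) = 0 from this, mul_zero]
  have h2 (ψ : AddChar (Additive Q) ℂ) : ψ (Additive.ofMul q₀⁻¹) *
      ∑ q : Q, h q * ψ (Additive.ofMul q) = ∑ q : Q, h q * ψ (Additive.ofMul (q₀⁻¹ * q)) := by
    rw [Finset.mul_sum]
    refine Finset.sum_congr rfl fun q _ => ?_
    rw [ofMul_mul, AddChar.map_add_eq_mul]
    ring
  simp_rw [h2] at h1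
  rw [Finset.sum_comm] at h1
  simp_rw [← Finset.mul_sum, AddChar.sum_apply_eq_ite] at h1
  rw [Finset.sum_eq_single q₀] at h1
  · simpa using h1
  · intro q _ hq
    rw [if_neg, mul_zero]
    rw [ofMul_eq_zero, inv_mul_eq_one]
    exact fun h => hq h.symm
  · simp

theorem eq_zero_of_forall_sum_mul_odd_char_eq_zero {ε : Q} {h : Q → ℂ}
    (hodd : ∀ q, h (ε * q) = -h q)
    (H : ∀ χ : Q →* ℂ, χ ε = -1 → ∑ q, h q * χ q = 0) : h = 0 := by
  refine eq_zero_of_forall_sum_mul_char_eq_zero h fun χ => ?_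
  by_cases hχ : χ ε = -1
  · exact H χ hχ
  · have h1 : ∑ q, h q * χ q = -χ ε * ∑ q, h q * χ q := by
      conv_lhs => rw [← Equiv.sum_comp (Equiv.mulLeft ε)]
      rw [Finset.mul_sum]
      refine Finset.sum_congr rfl fun q _ => ?_
      rw [Equiv.coe_mulLeft, hodd, map_mul]
      ring
    have h2 : (1 + χ ε) * ∑ q, h q * χ q = 0 := by linear_combination h1
    refine (mul_eq_zero.mp h2).resolve_left fun h3 => hχ ?_
    linear_combination h3

theorem sum_eq_two_mul_sum_of_even {R : Type*} [CommRing R] {ε : Q} (I : Set Q) [Fintype I]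
    (hε : ε * ε = 1) (hI : ∀ q, ε * q ∈ I ↔ q ∉ I) {g : Q → R} (hg : ∀ q, g (ε * q) = g q) :
    ∑ q, g q = 2 * ∑ a : I, g a := by
  classical
  rw [← Finset.sum_filter_add_sum_filter_not Finset.univ (· ∈ I) g, two_mul]
  have h1 : ∑ a : I, g a = ∑ q with q ∈ I, g q :=
    (Finset.sum_subtype _ (by simp) g).symm
  rw [h1]
  congr 1
  refine Finset.sum_nbij' (ε * ·) (ε * ·) ?_ ?_ ?_ ?_ ?_
  · intro q hq
    simpa [hI] using hq
  · intro q hq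
    simpa [hI] using hq
  · intro q _
    rw [← mul_assoc, hε, one_mul]
  · intro q _
    rw [← mul_assoc, hε, one_mul]
  · intro q _
    rw [hg]

/-- `I` represents `Q` modulo `ε`. A kernel vector on `I` extends to an odd function `V` on `Q`
whose convolution with `f` vanishes; if no odd coefficient of `f` vanishes, then all those of `V`
do, so `V = 0`. Conversely an odd `χ` killing `f` restricts to a kernel vector. -/
theorem det_of_odd_eq_zero_iff {ε : Q} (I : Set Q) [Fintype I] [DecidableEq I]
    (hε : ε * ε = 1) (hI : ∀ q, ε * q ∈ I ↔ q ∉ I) {f : Q → ℂ} (hf : ∀ q, f (ε * q) = -f q) :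
    (Matrix.of fun c a : I => f ((c : Q)⁻¹ * a)).det = 0 ↔
      ∃ χ : Q →* ℂ, χ ε = -1 ∧ ∑ q, f q * χ q = 0 := by
  classical
  rw [← Matrix.exists_mulVec_eq_zero_iff]
  constructor
  · rintro ⟨v, hv0, hv⟩
    by_contra! hne
    apply hv0
    set V : Q → ℂ := fun q => if h : q ∈ I then v ⟨q, h⟩ else
      if h : ε * q ∈ I then -v ⟨ε * q, h⟩ else 0 with hV
    have hVI (a : I) : V a = v a := by simp [hV]
    have hεε (q : Q) : ε * (ε * q) = q := by rw [← mul_assoc, hε, one_mul]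
    have hVodd (q : Q) : V (ε * q) = -V q := by
      by_cases hq : q ∈ I
      · have h1 : ε * q ∉ I := fun h => (hI q).mp h hq
        simp [hV, hq, h1, hεε]
      · have h1 : ε * q ∈ I := (hI q).mpr hq
        simp [hV, hq, h1]
    -- The product of two odd functions is even, so the full sum is twice a row of the matrix; rows
    -- outside `I` follow by oddness of `f`.
    have hconv (c : Q) : ∑ q, f (c⁻¹ * q) * V q = 0 := by
      have key (c : Q) (hc : c ∈ I) : ∑ q, f (c⁻¹ * q) * V q = 0 := by
        rw [sum_eq_two_mul_sum_of_even I hε hI]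
        · have := congrFun hv ⟨c, hc⟩
          simp only [Matrix.mulVec, dotProduct, Matrix.of_apply, Pi.zero_apply] at this
          simp_rw [hVI, this, mul_zero]
        · intro q
          rw [hVodd, mul_left_comm, hf]
          ring
      by_cases hc : c ∈ I
      · exact key c hc
      · have h1 := key (ε * c) ((hI c).mpr hc)
        have hεi : ε⁻¹ = ε := inv_eq_of_mul_eq_one_right hε
        simp_rw [mul_inv, hεi, mul_assoc, hf, neg_mul, Finset.sum_neg_distrib, neg_eq_zero] at h1
        exact h1
    have hV0 : V = 0 := by
      refine eq_zero_of_forall_sum_mul_odd_char_eq_zero hVodd fun χ hχ => ?_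
      have h1 : (∑ q, f q * χ q⁻¹) * ∑ q, V q * χ q = 0 := by
        have h2 : (∑ q, f q * χ q⁻¹) * ∑ q, V q * χ q =
            ∑ c, χ c * ∑ q, f (c⁻¹ * q) * V q := by
          simp_rw [Finset.mul_sum]
          rw [Finset.sum_comm (γ := Q)]
          refine Finset.sum_congr rfl fun q _ => ?_
          rw [Finset.sum_mul, ← Equiv.sum_comp ((Equiv.inv Q).trans (Equiv.mulRight q))]
          refine Finset.sum_congr rfl fun c _ => ?_
          simp only [Equiv.trans_apply, Equiv.inv_apply, Equiv.coe_mulRight, mul_inv, inv_inv,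
            map_mul]
          have : χ q⁻¹ * χ q = 1 := by rw [← map_mul, inv_mul_cancel, map_one]
          linear_combination f (c⁻¹ * q) * χ c * V q * this
        rw [h2]
        simp [hconv]
      refine (mul_eq_zero.mp h1).resolve_left ?_
      refine hne (χ.comp (invMonoidHom : Q →* Q)) ?_
      simp only [MonoidHom.comp_apply, invMonoidHom_apply]
      rw [inv_eq_of_mul_eq_one_right hε, hχ]
    funext a
    rw [← hVI, hV0]
    rfl
  · rintro ⟨χ, hχ, h0⟩
    refine ⟨fun a => χ a, ?_, ?_⟩
    · intro h
      obtain ⟨a⟩ : Nonempty I := by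
        by_cases h1 : (1 : Q) ∈ I
        · exact ⟨⟨1, h1⟩⟩
        · exact ⟨⟨_, (hI 1).mpr h1⟩⟩
      have h1 : χ a = 0 := congrFun h a
      have h2 : χ ((a : Q)⁻¹ * a) = 1 := by rw [inv_mul_cancel, map_one]
      rw [map_mul, h1, mul_zero] at h2
      exact zero_ne_one h2
    · funext c
      simp only [Matrix.mulVec, dotProduct, Matrix.of_apply, Pi.zero_apply]
      have h1 : ∑ q, f ((c : Q)⁻¹ * q) * χ q = 2 * ∑ a : I, f ((c : Q)⁻¹ * a) * χ a := by
        refine sum_eq_two_mul_sum_of_even I hε hI fun q => ?_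
        rw [mul_left_comm, hf, map_mul, hχ]
        ring
      have h2 : ∑ q, f ((c : Q)⁻¹ * q) * χ q = χ c * ∑ q, f q * χ q := by
        rw [← Equiv.sum_comp (Equiv.mulLeft (c : Q)), Finset.mul_sum]
        refine Finset.sum_congr rfl fun q _ => ?_
        rw [Equiv.coe_mulLeft, inv_mul_cancel_left, map_mul]
        ring
      rw [h2, h0, mul_zero] at h1
      simpa using h1.symm

theorem sum_comp_quotient_mk {Q : Type*} [CommGroup Q] [Fintype Q] (W : Subgroup Q)
    [Fintype (Q ⧸ W)] (F : Q ⧸ W → ℂ) :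
    ∑ g : Q, F (QuotientGroup.mk g) = (Nat.card W : ℂ) * ∑ q, F q := by
  classical
  rw [← Finset.sum_fiberwise Finset.univ (fun g : Q => (QuotientGroup.mk g : Q ⧸ W)),
    Finset.mul_sum]
  refine Finset.sum_congr rfl fun q _ => ?_
  rw [Finset.sum_congr rfl (g := fun _ => F q)
    (fun g hg => by rw [(Finset.mem_filter.mp hg).2]), Finset.sum_const, nsmul_eq_mul]
  congr 2
  obtain ⟨g, rfl⟩ := QuotientGroup.mk_surjective q
  have h := Nat.card_congr ((QuotientGroup.mk' W).fiberEquivKer g)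
  rw [QuotientGroup.ker_mk'] at h
  rw [← h, ← Nat.subtype_card (p := (· ∈ QuotientGroup.mk' W ⁻¹' {QuotientGroup.mk' W g}))]
  simp

end FiniteAbelian

/-! ### Singularity of `D` in terms of odd characters, and the group `W`. -/

namespace Demjanenko

section Units

variable {ℓ : ℕ} [Fact ℓ.Prime]

theorem units_val_pos (a : (ZMod ℓ)ˣ) : 0 < (a : ZMod ℓ).val := by
  rw [ZMod.val_pos]
  exact a.ne_zero

theorem units_val_neg (a : (ZMod ℓ)ˣ) :
    ((-a : (ZMod ℓ)ˣ) : ZMod ℓ).val + (a : ZMod ℓ).val = ℓ := by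
  have : NeZero (a : ZMod ℓ) := ⟨a.ne_zero⟩
  rw [Units.val_neg, ZMod.val_neg_of_ne_zero]
  exact Nat.sub_add_cancel (ZMod.val_lt _).le

theorem sum_char_mul_val_ne_zero {χ : (ZMod ℓ)ˣ →* ℂ} (hχ : χ (-1) = -1) :
    ∑ g, χ g * ((g : ZMod ℓ).val : ℂ) ≠ 0 := by
  set ψ : DirichletCharacter ℂ ℓ := MulChar.ofUnitHom χ.toHomUnits with hψ
  have hψg (g : (ZMod ℓ)ˣ) : ψ g = χ g := by
    rw [hψ, MulChar.ofUnitHom_coe, MonoidHom.coe_toHomUnits]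
  have hodd : ψ.Odd := by
    have := hψg (-1)
    rw [hχ] at this
    simpa [DirichletCharacter.Odd] using this
  have h := DirichletCharacter.sum_apply_mul_val_ne_zero_of_odd hodd
  have h2 : ∑ j : ZMod ℓ, ψ j * (j.val : ℂ) = ∑ g : (ZMod ℓ)ˣ, χ g * ((g : ZMod ℓ).val : ℂ) := by
    simp_rw [← hψg]
    symm
    refine Finset.sum_of_injOn (fun g : (ZMod ℓ)ˣ => (g : ZMod ℓ))
      (fun a _ b _ hab => Units.ext hab) (by simp) ?_ (by simp)
    intro j _ hj
    rw [MulChar.map_nonunit, zero_mul]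
    rintro ⟨u, hu⟩
    exact hj ⟨u, by simp, hu⟩
  rwa [← h2]

end Units

section Triple

variable {ℓ k : ℕ} [Fact ℓ.Prime] {x y : (ZMod ℓ)ˣ}

-- The sum is a multiple of `ℓ` strictly between `0` and `3ℓ`; as the third residue lies strictly
-- between `0` and `ℓ`, the first two decide between `ℓ` and `2ℓ`.
open Classical in
theorem val_add_val_add_val (hx : (x : ZMod ℓ) = k) (hxy : (1 + x + y : ZMod ℓ) = 0)
    (a : (ZMod ℓ)ˣ) :
    (a : ZMod ℓ).val + ((x * a : (ZMod ℓ)ˣ) : ZMod ℓ).val + ((y * a : (ZMod ℓ)ˣ) : ZMod ℓ).val =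
      if a ∈ M ℓ k then ℓ else 2 * ℓ := by
  have hdvd : ℓ ∣ (a : ZMod ℓ).val + ((x * a : (ZMod ℓ)ˣ) : ZMod ℓ).val +
      ((y * a : (ZMod ℓ)ˣ) : ZMod ℓ).val := by
    rw [← ZMod.natCast_eq_zero_iff]
    push_cast [ZMod.natCast_zmod_val]
    linear_combination (a : ZMod ℓ) * hxy
  have hM : a ∈ M ℓ k ↔ ((x * a : (ZMod ℓ)ˣ) : ZMod ℓ).val + (a : ZMod ℓ).val < ℓ := by
    rw [Units.val_mul, hx]
    rfl
  have h1 := units_val_pos a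
  have h2 := units_val_pos (x * a)
  have h3 := units_val_pos (y * a)
  have h4 := ZMod.val_lt (a : ZMod ℓ)
  have h5 := ZMod.val_lt ((x * a : (ZMod ℓ)ˣ) : ZMod ℓ)
  have h6 := ZMod.val_lt ((y * a : (ZMod ℓ)ˣ) : ZMod ℓ)
  obtain ⟨c, hc⟩ := hdvd
  have hc3 : c < 3 := by
    by_contra! h
    nlinarith
  rw [hc]
  interval_cases c
  · omega
  · rw [if_pos (hM.mpr (by omega)), mul_one]
  · rw [if_neg (fun h => by have := hM.mp h; omega), mul_comm]

theorem neg_mem_M_iff (hx : (x : ZMod ℓ) = k) (hxy : (1 + x + y : ZMod ℓ) = 0) (a : (ZMod ℓ)ˣ) :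
    -a ∈ M ℓ k ↔ a ∉ M ℓ k := by
  have h1 := val_add_val_add_val hx hxy a
  have h2 := val_add_val_add_val hx hxy (-a)
  have h3 := units_val_neg a
  have h4 := units_val_neg (x * a)
  have h5 := units_val_neg (y * a)
  have hpos := (Fact.out : ℓ.Prime).pos
  rw [mul_neg, mul_neg] at h2
  by_cases ha : a ∈ M ℓ k <;> by_cases hb : -a ∈ M ℓ k <;>
    simp only [ha, hb, if_true, if_false] at h1 h2 ⊢ <;> first | omega | simp

theorem E_mul_eq (hx : (x : ZMod ℓ) = k) (hxy : (1 + x + y : ZMod ℓ) = 0) (a : (ZMod ℓ)ˣ) :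
    (E ℓ k a : ℂ) * ℓ = (a : ZMod ℓ).val + ((x * a : (ZMod ℓ)ˣ) : ZMod ℓ).val +
      ((y * a : (ZMod ℓ)ˣ) : ZMod ℓ).val - ℓ := by
  have h := congrArg (Nat.cast : ℕ → ℂ) (val_add_val_add_val hx hxy a)
  push_cast at h ⊢
  rw [h, E]
  split_ifs <;> push_cast <;> ring

theorem E_neg (hx : (x : ZMod ℓ) = k) (hxy : (1 + x + y : ZMod ℓ) = 0) (a : (ZMod ℓ)ˣ) :
    E ℓ k (-a) = 1 - E ℓ k a := by
  unfold E
  by_cases ha : a ∈ M ℓ k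
  · rw [if_pos ha, if_neg (fun h => (neg_mem_M_iff hx hxy a).mp h ha), sub_zero]
  · rw [if_neg ha, if_pos ((neg_mem_M_iff hx hxy a).mpr ha), sub_self]

theorem sum_char_mul_comp_mul {G : Type*} [CommGroup G] [Fintype G] (χ : G →* ℂ) (v : G → ℂ)
    (x : G) : ∑ g, χ g * v (x * g) = χ x⁻¹ * ∑ g, χ g * v g := by
  rw [← Equiv.sum_comp (Equiv.mulLeft x⁻¹), Finset.mul_sum]
  refine Finset.sum_congr rfl fun g _ => ?_
  rw [Equiv.coe_mulLeft, mul_inv_cancel_left, map_mul, mul_assoc]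

theorem sum_char_eq_zero_of_odd {χ : (ZMod ℓ)ˣ →* ℂ} (hχ : χ (-1) = -1) : ∑ g, χ g = 0 := by
  have h := sum_char_mul_comp_mul χ (fun _ => 1) (-1)
  simp only [mul_one] at h
  rw [inv_neg, inv_one, hχ] at h
  linear_combination h / 2

theorem sum_char_mul_E (hx : (x : ZMod ℓ) = k) (hxy : (1 + x + y : ZMod ℓ) = 0)
    {χ : (ZMod ℓ)ˣ →* ℂ} (hχ : χ (-1) = -1) :
    (∑ g, χ g * (E ℓ k g : ℂ)) * ℓ =
      (1 + χ x⁻¹ + χ y⁻¹) * ∑ g, χ g * ((g : ZMod ℓ).val : ℂ) := by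
  rw [Finset.sum_mul]
  have h (g : (ZMod ℓ)ˣ) : χ g * (E ℓ k g : ℂ) * ℓ = χ g * ((g : ZMod ℓ).val : ℂ) +
      χ g * (((x * g : (ZMod ℓ)ˣ) : ZMod ℓ).val : ℂ) +
      χ g * (((y * g : (ZMod ℓ)ˣ) : ZMod ℓ).val : ℂ) - χ g * ℓ := by
    rw [mul_assoc, E_mul_eq hx hxy]
    ring
  simp_rw [h]
  rw [Finset.sum_sub_distrib, Finset.sum_add_distrib, Finset.sum_add_distrib,
    sum_char_mul_comp_mul χ (fun g => ((g : ZMod ℓ).val : ℂ)),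
    sum_char_mul_comp_mul χ (fun g => ((g : ZMod ℓ).val : ℂ)), ← Finset.sum_mul,
    sum_char_eq_zero_of_odd hχ]
  ring

theorem sum_char_mul_E_eq_zero_iff (hx : (x : ZMod ℓ) = k) (hxy : (1 + x + y : ZMod ℓ) = 0)
    {χ : (ZMod ℓ)ˣ →* ℂ} (hχ : χ (-1) = -1) :
    ∑ g, χ g * (E ℓ k g : ℂ) = 0 ↔ 1 + χ x⁻¹ + χ y⁻¹ = 0 := by
  have h := sum_char_mul_E hx hxy hχ
  have hB := sum_char_mul_val_ne_zero hχ
  have hℓ : (ℓ : ℂ) ≠ 0 := by exact_mod_cast (Fact.out : ℓ.Prime).ne_zero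
  constructor
  · intro h0
    rw [h0, zero_mul] at h
    exact (mul_eq_zero.mp h.symm).resolve_right hB
  · intro h0
    rw [h0, zero_mul] at h
    exact (mul_eq_zero.mp h).resolve_right hℓ

/-- The shift by `1/2` makes the matrix function odd on the quotient by `W`, and `M / W` is a system
of representatives modulo `-1`, so `det_of_odd_eq_zero_iff` applies; the constant `1/2` drops out
against odd characters. Passing to `χ⁻¹` removes the inverses. -/
theorem det_D_eq_zero_iff [DecidableEq (Index ℓ k)] (hx : (x : ZMod ℓ) = k)
    (hxy : (1 + x + y : ZMod ℓ) = 0) :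
    (D ℓ k).det = 0 ↔ ∃ χ : (ZMod ℓ)ˣ →* ℂ, χ (-1) = -1 ∧ (∀ w ∈ W ℓ k, χ w = 1) ∧
      1 + χ x + χ y = 0 := by
  classical
  have : Fintype ((ZMod ℓ)ˣ ⧸ W ℓ k) := Fintype.ofFinite _
  set ε : (ZMod ℓ)ˣ ⧸ W ℓ k := QuotientGroup.mk (-1) with hε
  set f : (ZMod ℓ)ˣ ⧸ W ℓ k → ℂ := fun q => ((EQuot ℓ k (ε * q) - 1 / 2 : ℚ) : ℂ) with hf
  have hεε : ε * ε = 1 := by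
    rw [hε, ← QuotientGroup.mk_mul, neg_one_mul, neg_neg, QuotientGroup.mk_one]
  have hmem (a : (ZMod ℓ)ˣ) : (QuotientGroup.mk a : (ZMod ℓ)ˣ ⧸ W ℓ k) ∈
      (QuotientGroup.mk '' M ℓ k : Set ((ZMod ℓ)ˣ ⧸ W ℓ k)) ↔ a ∈ M ℓ k := by
    refine ⟨?_, fun h => ⟨a, h, rfl⟩⟩
    rintro ⟨b, hb, hba⟩
    have h1 := mul_mem_M_iff (QuotientGroup.eq.mp hba) b
    rw [mul_comm b⁻¹ a, inv_mul_cancel_right] at h1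
    exact h1.mpr hb
  have hneg (a : (ZMod ℓ)ˣ) : ε * QuotientGroup.mk a = QuotientGroup.mk (-a) := by
    rw [hε, ← QuotientGroup.mk_mul, neg_one_mul]
  have hI (q : (ZMod ℓ)ˣ ⧸ W ℓ k) :
      ε * q ∈ (QuotientGroup.mk '' M ℓ k : Set ((ZMod ℓ)ˣ ⧸ W ℓ k)) ↔
        q ∉ (QuotientGroup.mk '' M ℓ k : Set ((ZMod ℓ)ˣ ⧸ W ℓ k)) := by
    obtain ⟨a, rfl⟩ := QuotientGroup.mk_surjective q
    rw [hneg, hmem, hmem, neg_mem_M_iff hx hxy]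
  have hfmk (a : (ZMod ℓ)ˣ) : f (QuotientGroup.mk a) = ((E ℓ k (-a) - 1 / 2 : ℚ) : ℂ) := by
    rw [hf]
    simp only [hneg]
    rfl
  have hfodd (q : (ZMod ℓ)ˣ ⧸ W ℓ k) : f (ε * q) = -f q := by
    obtain ⟨a, rfl⟩ := QuotientGroup.mk_surjective q
    rw [hneg, hfmk, hfmk, neg_neg, E_neg hx hxy]
    push_cast
    ring
  have hdet : (D ℓ k).det = 0 ↔
      (Matrix.of fun c a : Index ℓ k => f ((c : (ZMod ℓ)ˣ ⧸ W ℓ k)⁻¹ * a)).det = 0 := by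
    have h1 : (Matrix.of fun c a : Index ℓ k => f ((c : (ZMod ℓ)ˣ ⧸ W ℓ k)⁻¹ * a)) =
        (algebraMap ℚ ℂ).mapMatrix (D ℓ k) := by
      ext c a
      simp only [hf, D, RingHom.mapMatrix_apply, Matrix.map_apply, Matrix.of_apply, mul_assoc]
      rfl
    rw [h1, ← RingHom.map_det, map_eq_zero]
  have hsum (χ : (ZMod ℓ)ˣ ⧸ W ℓ k →* ℂ) (hχ : χ ε = -1) :
      ∑ q, f q * χ q = 0 ↔ 1 + χ (QuotientGroup.mk x)⁻¹ + χ (QuotientGroup.mk y)⁻¹ = 0 := by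
    set ψ : (ZMod ℓ)ˣ →* ℂ := χ.comp (QuotientGroup.mk' (W ℓ k)) with hψ
    have hψ1 : ψ (-1) = -1 := hχ
    have h1 := sum_comp_quotient_mk (W ℓ k) (fun q => f q * χ q)
    have h2 : ∑ g : (ZMod ℓ)ˣ, f (QuotientGroup.mk g) * χ (QuotientGroup.mk g) =
        -∑ g, ψ g * (E ℓ k g : ℂ) := by
      have h3 (g : (ZMod ℓ)ˣ) : f (QuotientGroup.mk g) * χ (QuotientGroup.mk g) =
          ψ g * (1 / 2) - ψ g * (E ℓ k g : ℂ) := by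
        rw [hfmk, E_neg hx hxy]
        change _ * ψ g = _
        push_cast
        ring
      simp_rw [h3]
      rw [Finset.sum_sub_distrib, ← Finset.sum_mul, sum_char_eq_zero_of_odd hψ1]
      ring
    have hW : (Nat.card (W ℓ k) : ℂ) ≠ 0 := by
      exact_mod_cast Nat.card_pos.ne'
    rw [h2] at h1
    have h4 := sum_char_mul_E_eq_zero_iff hx hxy hψ1
    rw [← QuotientGroup.mk_inv, ← QuotientGroup.mk_inv]
    refine Iff.trans ?_ h4
    constructor
    · intro h0
      rw [h0, mul_zero] at h1
      exact neg_eq_zero.mp h1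
    · intro h0
      rw [h0, neg_zero] at h1
      exact (mul_eq_zero.mp h1.symm).resolve_left hW
  rw [hdet]
  refine (det_of_odd_eq_zero_iff _ hεε hI hfodd).trans ?_
  constructor
  · rintro ⟨χ, hχ, h0⟩
    rw [hsum χ hχ] at h0
    refine ⟨(χ.comp (QuotientGroup.mk' (W ℓ k))).comp invMonoidHom, ?_, ?_, ?_⟩
    · simp only [MonoidHom.comp_apply, invMonoidHom_apply, inv_neg, inv_one]
      exact hχ
    · intro w hw
      change χ (QuotientGroup.mk w⁻¹) = 1
      rw [(QuotientGroup.eq_one_iff _).mpr ((W ℓ k).inv_mem hw), map_one]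
    · exact h0
  · rintro ⟨χ, hχ, hW, h0⟩
    set ψ := QuotientGroup.lift (W ℓ k) (χ.comp invMonoidHom)
      (fun w hw => hW _ ((W ℓ k).inv_mem hw)) with hψ
    have hψmk (a : (ZMod ℓ)ˣ) : ψ (QuotientGroup.mk a) = χ a⁻¹ := rfl
    have hψε : ψ ε = -1 := by rw [hε, hψmk, inv_neg, inv_one, hχ]
    refine ⟨ψ, hψε, ?_⟩
    rw [hsum ψ hψε, ← QuotientGroup.mk_inv, ← QuotientGroup.mk_inv, hψmk, hψmk, inv_inv, inv_inv,
      h0]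

theorem mem_W_of_forall_E_eq {w : (ZMod ℓ)ˣ} (h : ∀ a, E ℓ k (w * a) = E ℓ k a) : w ∈ W ℓ k := by
  have h1 (a : (ZMod ℓ)ˣ) : w * a ∈ M ℓ k ↔ a ∈ M ℓ k := by
    have := h a
    unfold E at this
    split_ifs at this <;> simp_all
  change w • M ℓ k = M ℓ k
  ext a
  rw [Set.mem_smul_set_iff_inv_smul_mem, ← h1, smul_eq_mul, mul_inv_cancel_left]

open Classical in
theorem E_mul_of_mem_W {w : (ZMod ℓ)ˣ} (h : w ∈ W ℓ k) (a : (ZMod ℓ)ˣ) :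
    E ℓ k (w * a) = E ℓ k a := by
  exact if_congr (mul_mem_M_iff h a) rfl rfl

/-- If `x` is a root of `X ^ 2 + X + 1`, then multiplication by `x` permutes `1, x, y`
cyclically and hence stabilizes `M`. -/
theorem mem_W_of_sq_eq (hx : (x : ZMod ℓ) = k) (hxy : (1 + x + y : ZMod ℓ) = 0) (h : x * x = y) :
    x ∈ W ℓ k := by
  have hℓ : (ℓ : ℂ) ≠ 0 := by exact_mod_cast (Fact.out : ℓ.Prime).ne_zero
  have hyx : y * x = 1 := by
    ext
    have h' := congrArg (Units.val) h
    push_cast at h' ⊢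
    linear_combination ((x : ZMod ℓ) - 1) * hxy - h'
  refine mem_W_of_forall_E_eq fun a => ?_
  have h1 := E_mul_eq hx hxy a
  have h2 := E_mul_eq hx hxy (x * a)
  rw [← mul_assoc, ← mul_assoc, h, hyx, one_mul] at h2
  have h3 : (E ℓ k (x * a) : ℂ) = E ℓ k a := by
    apply mul_right_cancel₀ hℓ
    rw [h1, h2]
    ring
  exact_mod_cast h3

/-- Invariance of `E` under `w` and `B ≠ 0` give `(χ(w) - 1)(1 + χ(x) + χ(y)) = 0` for every odd
`χ`. Hence the counting function `m` of `1, x, y` and its translate by `w` have the same odd part.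
No two of `1, x, y` are opposite, so `w⁻¹` maps `{1, x, y}` into itself, which forces `w = 1` or `x²
= y`. -/
theorem eq_one_of_mem_W (hx : (x : ZMod ℓ) = k) (hxy : (1 + x + y : ZMod ℓ) = 0) (h : x * x ≠ y)
    (hℓ2 : ℓ ≠ 2) {w : (ZMod ℓ)ˣ} (hw : w ∈ W ℓ k) : w = 1 := by
  classical
  set m : (ZMod ℓ)ˣ → ℂ := fun g =>
    (if g = 1 then 1 else 0) + (if g = x then 1 else 0) + (if g = y then 1 else 0) with hm
  have hsum_m (χ : (ZMod ℓ)ˣ →* ℂ) : ∑ g, χ g * m g = 1 + χ x + χ y := by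
    simp [hm, mul_add, Finset.sum_add_distrib]
  have hodd : (fun g => (m (w⁻¹ * g) - m g) - (m (w⁻¹ * -g) - m (-g))) = 0 := by
    refine eq_zero_of_forall_sum_mul_odd_char_eq_zero (ε := (-1 : (ZMod ℓ)ˣ)) ?_ ?_
    · intro q
      simp only [neg_one_mul, neg_neg]
      ring
    · intro χ hχ
      have hχinv : (χ.comp (invMonoidHom : (ZMod ℓ)ˣ →* _)) (-1) = -1 := by
        simp only [MonoidHom.comp_apply, invMonoidHom_apply, inv_neg, inv_one, hχ]
      have h1 := sum_char_mul_E hx hxy hχinv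
      have h2 := sum_char_mul_comp_mul (χ.comp (invMonoidHom : (ZMod ℓ)ˣ →* _))
        (fun g => (E ℓ k g : ℂ)) w
      simp only [E_mul_of_mem_W hw] at h2
      simp only [MonoidHom.comp_apply, invMonoidHom_apply, inv_inv] at h1 h2
      have hB := sum_char_mul_val_ne_zero hχinv
      simp only [MonoidHom.comp_apply, invMonoidHom_apply] at hB
      have h3 : (χ w - 1) * (1 + χ x + χ y) = 0 := by
        apply (mul_eq_zero.mp _).resolve_right hB
        linear_combination -(χ w - 1) * h1 - (ℓ : ℂ) * h2
      have hn (u : (ZMod ℓ)ˣ → ℂ) : ∑ g, χ g * u (-g) = -∑ g, χ g * u g := by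
        have := sum_char_mul_comp_mul χ u (-1)
        simp only [neg_one_mul, inv_neg, inv_one, hχ] at this
        exact this
      have hs : ∑ g, χ g * m (w⁻¹ * g) = χ w * ∑ g, χ g * m g := by
        rw [sum_char_mul_comp_mul, inv_inv]
      have h4 : ∑ q, (m (w⁻¹ * q) - m q - (m (w⁻¹ * -q) - m (-q))) * χ q =
          (∑ g, χ g * m (w⁻¹ * g) - ∑ g, χ g * m g) -
          (∑ g, χ g * m (w⁻¹ * -g) - ∑ g, χ g * m (-g)) := by
        rw [← Finset.sum_sub_distrib, ← Finset.sum_sub_distrib, ← Finset.sum_sub_distrib]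
        refine Finset.sum_congr rfl fun g _ => ?_
        ring
      rw [h4, hn m, hn (fun g => m (w⁻¹ * g)), hs, hsum_m]
      linear_combination 2 * h3
  have h2 : (2 : ZMod ℓ) ≠ 0 := by
    intro h2
    have h3 : ℓ ∣ 2 := (ZMod.natCast_eq_zero_iff 2 ℓ).mp (by exact_mod_cast h2)
    exact hℓ2 (le_antisymm (Nat.le_of_dvd two_pos h3) (Fact.out : ℓ.Prime).two_le)
  have ne1 (u : (ZMod ℓ)ˣ) : -u ≠ u := fun hu => by
    have := congrArg Units.val hu
    push_cast at this
    have h3 : (2 : ZMod ℓ) * u = 0 := by linear_combination -this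
    exact (mul_eq_zero.mp h3).elim h2 u.ne_zero
  have hx1 : (x : ZMod ℓ) ≠ -1 := fun hu => y.ne_zero (by linear_combination hxy - hu)
  have hy1 : (y : ZMod ℓ) ≠ -1 := fun hu => x.ne_zero (by linear_combination hxy - hu)
  have hyx : (y : ZMod ℓ) ≠ -x := fun hu =>
    one_ne_zero (α := ZMod ℓ) (by linear_combination hxy - hu)
  have hval {u v : (ZMod ℓ)ˣ} (huv : u = v) : (u : ZMod ℓ) = v := by rw [huv]
  have key (g : (ZMod ℓ)ˣ) (hg : g = 1 ∨ g = x ∨ g = y) :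
      w⁻¹ * g = 1 ∨ w⁻¹ * g = x ∨ w⁻¹ * g = y := by
    by_contra! hne
    have h0 := congrFun hodd g
    simp only [Pi.zero_apply] at h0
    have hwg : m (w⁻¹ * g) = 0 := by simp [hm, hne]
    have hmg : m (-g) = 0 := by
      have a1 : -g ≠ 1 := by
        rintro hc
        rcases hg with rfl | rfl | rfl
        · exact ne1 1 hc
        · exact hx1 (by have := hval hc; push_cast at this; linear_combination -this)
        · exact hy1 (by have := hval hc; push_cast at this; linear_combination -this)
      have a2 : -g ≠ x := by
        rintro hc
        rcases hg with rfl | rfl | rfl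
        · exact hx1 (by have := hval hc; push_cast at this; linear_combination -this)
        · exact ne1 _ hc
        · exact hyx (by have := hval hc; push_cast at this; linear_combination -this)
      have a3 : -g ≠ y := by
        rintro hc
        rcases hg with rfl | rfl | rfl
        · exact hy1 (by have := hval hc; push_cast at this; linear_combination -this)
        · exact hyx (by have := hval hc; push_cast at this; linear_combination -this)
        · exact ne1 _ hc
      simp [hm, a1, a2, a3]
    rw [hwg, hmg] at h0
    -- Both terms are nonnegative integers and `m g` is positive, a contradiction.
    have h3 : m g + m (w⁻¹ * -g) = 0 := by linear_combination -h0
    simp only [hm] at h3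
    split_ifs at h3 <;> first | (norm_num at h3; done) | simp_all
  have k1 := key 1 (Or.inl rfl)
  have kx := key x (Or.inr (Or.inl rfl))
  have ky := key y (Or.inr (Or.inr rfl))
  rw [mul_one] at k1
  by_contra hw1
  have hsq {u : (ZMod ℓ)ˣ} (hu : u * u = 1) (hu' : (u : ZMod ℓ) ≠ -1) : u = 1 := by
    have := hval hu
    push_cast at this
    have h3 : ((u : ZMod ℓ) - 1) * (u + 1) = 0 := by linear_combination this
    rcases mul_eq_zero.mp h3 with h4 | h4
    · exact Units.ext (by push_cast; linear_combination h4)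
    · exact absurd (by linear_combination h4) hu'
  rcases k1 with h1 | h1 | h1
  · exact hw1 (inv_eq_one.mp h1)
  · rw [h1] at kx
    rcases kx with h3 | h3 | h3
    · exact hw1 (inv_eq_one.mp (h1.trans (hsq h3 hx1)))
    · exact hw1 (inv_eq_one.mp (h1.trans (mul_eq_left.mp h3)))
    · exact h h3
  · rw [h1] at ky
    rcases ky with h3 | h3 | h3
    · exact hw1 (inv_eq_one.mp (h1.trans (hsq h3 hy1)))
    · refine h (Units.ext ?_)
      have h4 := hval h3
      push_cast at h4 ⊢
      have h5 : (x : ZMod ℓ) = -1 - y := by linear_combination hxy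
      rw [h5] at h4 ⊢
      linear_combination h4
    · exact hw1 (inv_eq_one.mp (h1.trans (mul_eq_left.mp h3)))

theorem det_D_eq_zero_iff_of_sq_ne [DecidableEq (Index ℓ k)] (hx : (x : ZMod ℓ) = k)
    (hxy : (1 + x + y : ZMod ℓ) = 0) (h : x * x ≠ y) (hℓ2 : ℓ ≠ 2) :
    (D ℓ k).det = 0 ↔ ∃ χ : (ZMod ℓ)ˣ →* ℂ, χ (-1) = -1 ∧ 1 + χ x + χ y = 0 := by
  rw [det_D_eq_zero_iff hx hxy]
  refine exists_congr fun χ => and_congr_right fun _ => and_iff_right fun w hw => ?_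
  rw [eq_one_of_mem_W hx hxy h hℓ2 hw, map_one]

/-- Here `x` and `y = x²` lie in `W`, so an admissible `χ` would give `1 + 1 + 1 = 0`. -/
theorem det_D_ne_zero_of_sq_eq [DecidableEq (Index ℓ k)] (hx : (x : ZMod ℓ) = k)
    (hxy : (1 + x + y : ZMod ℓ) = 0) (h : x * x = y) : (D ℓ k).det ≠ 0 := by
  rw [Ne, det_D_eq_zero_iff hx hxy]
  rintro ⟨χ, _, hW, h0⟩
  rw [← h, map_mul, hW x (mem_W_of_sq_eq hx hxy h)] at h0
  norm_num at h0

end Triple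

end Demjanenko

/-- Conjugation inverts unit complex numbers, so the conjugate relation multiplied by `uv` yields
`uv = 1`. -/
theorem one_add_add_eq_zero_iff_of_norm_eq_one {u v : ℂ} (hu : ‖u‖ = 1) (hv : ‖v‖ = 1) :
    1 + u + v = 0 ↔ u * v = 1 ∧ u ^ 3 = 1 ∧ u ≠ 1 := by
  constructor
  · intro h
    have hu' : u * (starRingEnd ℂ) u = 1 := by
      rw [Complex.mul_conj, Complex.normSq_eq_norm_sq, hu]; norm_num
    have hv' : v * (starRingEnd ℂ) v = 1 := by
      rw [Complex.mul_conj, Complex.normSq_eq_norm_sq, hv]; norm_num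
    have hc := congrArg (starRingEnd ℂ) h
    simp only [map_add, map_one, map_zero] at hc
    have huv : u * v = 1 := by
      linear_combination (u * v) * hc - v * hu' - u * hv' - h
    refine ⟨huv, ?_, ?_⟩
    · linear_combination (u - 1) * u * h - (u - 1) * huv
    · rintro rfl
      have h1 : v = -2 := by linear_combination h
      rw [h1] at hv
      norm_num at hv
  · rintro ⟨huv, h3, h1⟩
    have h2 : 1 + u + u ^ 2 = 0 := by
      have : (u - 1) * (1 + u + u ^ 2) = 0 := by linear_combination h3
      exact (mul_eq_zero.mp this).resolve_left (sub_ne_zero.mpr h1)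
    linear_combination h2 - v * h3 + u ^ 2 * huv

/-! ### Translation into divisibility of discrete logarithms. -/

section CyclicCharacters

variable {G : Type*} [CommGroup G] {n : ℕ} [NeZero n] (e : G ≃* Multiplicative (ZMod n))

/-- The discrete logarithm of `x` with respect to an isomorphism of a cyclic group with
`ZMod n`, as a natural number less than `n`. -/
def discreteLog (x : G) : ℕ := (Multiplicative.toAdd (e x)).val

theorem pow_discreteLog (x : G) : e.symm (Multiplicative.ofAdd 1) ^ discreteLog e x = x := by
  rw [← map_pow, ← ofAdd_nsmul, nsmul_one, discreteLog, ZMod.natCast_zmod_val, ofAdd_toAdd,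
    MulEquiv.symm_apply_apply]

theorem dvd_two_mul_discreteLog {ε : G} (hε : ε * ε = 1) : n ∣ 2 * discreteLog e ε := by
  rw [← ZMod.natCast_eq_zero_iff, Nat.cast_mul, discreteLog, ZMod.natCast_zmod_val, Nat.cast_two,
    two_mul, ← toAdd_mul, ← map_mul, hε, map_one, toAdd_one]

theorem not_dvd_discreteLog {ε : G} (hε : ε ≠ 1) : ¬ n ∣ discreteLog e ε := by
  rw [← ZMod.natCast_eq_zero_iff, discreteLog, ZMod.natCast_zmod_val, toAdd_eq_zero]
  exact fun h => hε ((map_eq_one_iff e e.injective).mp h)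

theorem exists_char_apply_eq_pow {ζ : ℂ} (hζ : ζ ^ n = 1) :
    ∃ χ : G →* ℂ, ∀ x, χ x = ζ ^ discreteLog e x := by
  refine ⟨(AddChar.zmodChar n hζ).toMonoidHom.comp e.toMonoidHom, fun x => ?_⟩
  exact AddChar.zmodChar_apply hζ _

/-- A character is given by its value `ζ` on a generator. If `ζ` has order `d`, oddness forces `2^α
∣ d`, and the cube root conditions read `d ∣ 3a`, `d ∤ a`, `d ∣ a + b`; the exponent of `3` in `d`
is then `s + 1`. Conversely a root of unity of order `2^α 3^(s+1)` suffices. -/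
theorem exists_odd_char_iff {α β m : ℕ} (hα : 0 < α) (hm : Nat.gcd m 6 = 1)
    (hn : n = 2 ^ α * 3 ^ β * m) {ε : G} (hε : ε * ε = 1) (hε1 : ε ≠ 1) (x y : G) :
    (∃ χ : G →* ℂ, χ ε = -1 ∧ 1 + χ x + χ y = 0) ↔
      ∃ s ∈ Finset.range β, (2 ^ α ∣ discreteLog e x ∧ 2 ^ α ∣ discreteLog e y) ∧
        3 ^ s ∣ discreteLog e x ∧ ¬ 3 ^ (s + 1) ∣ discreteLog e x ∧
        3 ^ (s + 1) ∣ discreteLog e x + discreteLog e y := by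
  have hm2 : Nat.Coprime m 2 := Nat.Coprime.coprime_dvd_right (by norm_num) hm
  have hm3 : Nat.Coprime m 3 := Nat.Coprime.coprime_dvd_right (by norm_num) hm
  have hn0 : n ≠ 0 := NeZero.ne n
  have hc2 := dvd_two_mul_discreteLog e hε
  have hc1 := not_dvd_discreteLog e hε1
  have hodd : Nat.Coprime 2 (3 ^ β * m) :=
    Nat.Coprime.mul_right (Nat.Coprime.pow_right _ (by norm_num)) hm2.symm
  constructor
  · rintro ⟨χ, hχε, hχ⟩
    set ζ := χ (e.symm (Multiplicative.ofAdd 1)) with hζ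
    have hχz (z : G) : χ z = ζ ^ discreteLog e z := by
      rw [hζ, ← map_pow, pow_discreteLog]
    have hζn : ζ ^ n = 1 := by
      rw [hζ, ← map_pow, ← map_pow, ← ofAdd_nsmul, nsmul_one, ZMod.natCast_self, ofAdd_zero,
        map_one, map_one]
    have hζ1 : ‖ζ‖ = 1 := Complex.norm_eq_one_of_pow_eq_one hζn hn0
    have hχ1 (z : G) : ‖χ z‖ = 1 := by rw [hχz, norm_pow, hζ1, one_pow]
    obtain ⟨huv, hu3, hu1⟩ := (one_add_add_eq_zero_iff_of_norm_eq_one (hχ1 x) (hχ1 y)).mp hχ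
    rw [hχz x] at hu3 hu1
    rw [hχz x, hχz y, ← pow_add] at huv
    rw [← pow_mul] at hu3
    set d := orderOf ζ with hd
    have hdn : d ∣ n := orderOf_dvd_of_pow_eq_one hζn
    have hd3 : d ∣ discreteLog e x * 3 := orderOf_dvd_of_pow_eq_one hu3
    have hda : ¬ d ∣ discreteLog e x := fun h => hu1 (orderOf_dvd_iff_pow_eq_one.mp h)
    have hdab : d ∣ discreteLog e x + discreteLog e y := orderOf_dvd_of_pow_eq_one huv
    have hd0 : d ≠ 0 := fun h => hn0 (Nat.eq_zero_of_zero_dvd (h ▸ hdn))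
    -- Otherwise `d` divides `n / 2`, which divides the logarithm of `ε`, and `χ ε = 1`.
    have hdα : 2 ^ α ∣ d := by
      by_contra hnd
      have h1 : d ∣ 2 ^ (α - 1) * (3 ^ β * m) := by
        obtain ⟨j, d', hd', hdj⟩ := Nat.exists_eq_pow_mul_and_not_dvd hd0 2 (by norm_num)
        have hj : j < α := by
          by_contra! hj
          exact hnd (hdj ▸ Dvd.dvd.mul_right (pow_dvd_pow 2 hj) d')
        rw [hdj]
        refine mul_dvd_mul (pow_dvd_pow 2 (by omega)) ?_
        have h2 : d' ∣ 2 ^ α * (3 ^ β * m) := by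
          rw [← mul_assoc, ← hn]
          exact (Dvd.intro_left _ hdj.symm).trans hdn
        refine Nat.Coprime.dvd_of_dvd_mul_left (Nat.Coprime.pow_right _ ?_) h2
        exact ((Nat.Prime.coprime_iff_not_dvd Nat.prime_two).mpr hd').symm
      have h2 : 2 * (2 ^ (α - 1) * (3 ^ β * m)) ∣ 2 * discreteLog e ε := by
        rw [← mul_assoc, ← pow_succ', Nat.sub_add_cancel hα, ← mul_assoc, ← hn]
        exact hc2
      have h3 : d ∣ discreteLog e ε := h1.trans (Nat.dvd_of_mul_dvd_mul_left two_pos h2)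
      rw [hχz, orderOf_dvd_iff_pow_eq_one.mp h3] at hχε
      norm_num at hχε
    have hx2 : 2 ^ α ∣ discreteLog e x :=
      Nat.Coprime.dvd_of_dvd_mul_right (Nat.Coprime.pow_left _ (by norm_num)) (hdα.trans hd3)
    have hy2 : 2 ^ α ∣ discreteLog e y := (Nat.dvd_add_right hx2).mp (hdα.trans hdab)
    obtain ⟨t, d', hd', hdt⟩ := Nat.exists_eq_pow_mul_and_not_dvd hd0 3 (by norm_num)
    have hd'3 : Nat.Coprime d' 3 := ((Nat.Prime.coprime_iff_not_dvd Nat.prime_three).mpr hd').symm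
    have htd : 3 ^ t ∣ d := Dvd.intro _ hdt.symm
    have hd'x : d' ∣ discreteLog e x :=
      Nat.Coprime.dvd_of_dvd_mul_right hd'3 ((Dvd.intro_left _ hdt.symm).trans hd3)
    have htx : ¬ 3 ^ t ∣ discreteLog e x := fun h => hda <| by
      rw [hdt]
      exact Nat.Coprime.mul_dvd_of_dvd_of_dvd (Nat.Coprime.pow_left _ hd'3.symm) h hd'x
    obtain ⟨s, rfl⟩ : ∃ s, t = s + 1 := Nat.exists_eq_succ_of_ne_zero (by
      rintro rfl
      exact htx (by simp))
    have hsβ : s + 1 ≤ β := by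
      have h1 : 3 ^ (s + 1) ∣ 3 ^ β * (2 ^ α * m) := by
        have := htd.trans hdn
        rwa [hn, mul_comm (2 ^ α), mul_assoc] at this
      have h2 := Nat.Coprime.dvd_of_dvd_mul_right (Nat.Coprime.pow_left _
        (Nat.Coprime.mul_right (Nat.Coprime.pow_right _ (by norm_num)) hm3.symm)) h1
      exact (Nat.pow_dvd_pow_iff_le_right (by norm_num)).mp h2
    refine ⟨s, Finset.mem_range.mpr hsβ, ⟨hx2, hy2⟩, ?_, htx, htd.trans hdab⟩
    exact Nat.dvd_of_mul_dvd_mul_right (k := 3) (by norm_num) (by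
      rw [← pow_succ]
      exact htd.trans hd3)
  · rintro ⟨s, hs, ⟨hx2, hy2⟩, hsx, hsx', hsxy⟩
    have hcop : Nat.Coprime (2 ^ α) (3 ^ (s + 1)) :=
      Nat.Coprime.pow _ _ (by norm_num)
    set d := 2 ^ α * 3 ^ (s + 1) with hd
    have hd0 : d ≠ 0 := by positivity
    have hdn : d ∣ n := by
      rw [hn]
      exact Dvd.dvd.mul_right (mul_dvd_mul_left _ (pow_dvd_pow 3 (Finset.mem_range.mp hs))) m
    have hprim := Complex.isPrimitiveRoot_exp d hd0
    set ζ := Complex.exp (2 * Real.pi * Complex.I / d) with hζ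
    have hζn : ζ ^ n = 1 := (hprim.pow_eq_one_iff_dvd n).mpr hdn
    have hζ1 : ‖ζ‖ = 1 := Complex.norm_eq_one_of_pow_eq_one hζn hn0
    obtain ⟨χ, hχ⟩ := exists_char_apply_eq_pow e hζn
    have hχ1 (z : G) : ‖χ z‖ = 1 := by rw [hχ, norm_pow, hζ1, one_pow]
    refine ⟨χ, ?_, (one_add_add_eq_zero_iff_of_norm_eq_one (hχ1 x) (hχ1 y)).mpr ⟨?_, ?_, ?_⟩⟩
    -- If `χ ε = 1`, then `2^α` divides the logarithm of `ε`; the odd part of `n` divides it anyway,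
    -- so `n` would, contradicting `ε ≠ 1`.
    · have h1 : χ ε * χ ε = 1 := by rw [← map_mul, hε, map_one]
      refine (mul_self_eq_one_iff.mp h1).resolve_left fun h2 => hc1 ?_
      rw [hχ, hprim.pow_eq_one_iff_dvd] at h2
      refine (dvd_of_eq (hn.trans (mul_assoc _ _ _))).trans ?_
      refine Nat.Coprime.mul_dvd_of_dvd_of_dvd (Nat.Coprime.pow_left _ hodd)
        ((Dvd.intro _ rfl).trans h2) ?_
      refine Nat.Coprime.dvd_of_dvd_mul_left hodd.symm (Dvd.dvd.trans ?_ hc2)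
      rw [hn, mul_assoc]
      exact Dvd.intro_left _ rfl
    · rw [hχ, hχ, ← pow_add, hprim.pow_eq_one_iff_dvd]
      exact Nat.Coprime.mul_dvd_of_dvd_of_dvd hcop (dvd_add hx2 hy2) hsxy
    · rw [hχ, ← pow_mul, hprim.pow_eq_one_iff_dvd]
      refine Nat.Coprime.mul_dvd_of_dvd_of_dvd hcop (Dvd.dvd.mul_right hx2 3) ?_
      rw [pow_succ]
      exact mul_dvd_mul_right hsx 3
    · rw [hχ, Ne, hprim.pow_eq_one_iff_dvd]
      exact fun h => hsx' ((Dvd.intro_left _ rfl).trans h)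

end CyclicCharacters

/-! ### Jacobi sums and equidistribution on the line `1 + x + y = 0`. -/

section LineCount

variable {F : Type*} [Field F]

theorem ofUnitHom_toHomUnits_eq_one_iff (χ : Fˣ →* ℂ) :
    MulChar.ofUnitHom χ.toHomUnits = 1 ↔ χ = 1 := by
  constructor
  · intro h
    ext g
    have h1 := MulChar.ofUnitHom_coe χ.toHomUnits g
    rw [h, MulChar.one_apply_coe, MonoidHom.coe_toHomUnits] at h1
    exact h1.symm
  · rintro rfl
    ext g
    rw [MulChar.ofUnitHom_coe, MonoidHom.coe_toHomUnits, MulChar.one_apply_coe]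
    rfl

variable [Fintype F]

theorem norm_jacobiSum_le {χ ψ : MulChar F ℂ} (h : χ ≠ 1 ∨ ψ ≠ 1) :
    ‖jacobiSum χ ψ‖ ≤ √(Fintype.card F) := by
  have hcard : (1 : ℝ) ≤ √(Fintype.card F) := by
    rw [Real.one_le_sqrt]
    exact_mod_cast Fintype.card_pos
  by_cases hχ : χ = 1
  · subst hχ
    rw [jacobiSum_one_nontrivial (by simpa using h)]
    simpa using hcard
  by_cases hψ : ψ = 1
  · subst hψ
    rw [jacobiSum_comm, jacobiSum_one_nontrivial hχ]
    simpa using hcard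
  by_cases hχψ : χ * ψ = 1
  · rw [eq_inv_of_mul_eq_one_right hχψ, jacobiSum_nontrivial_inv hχ, norm_neg]
    have h1 : χ (-1) * χ (-1) = 1 := by rw [← map_mul]; simp
    have h2 : ‖χ (-1)‖ = 1 := by
      rcases mul_self_eq_one_iff.mp h1 with h3 | h3 <;> rw [h3] <;> simp
    rwa [h2]
  · have hchar : ringChar ℂ ≠ ringChar F := by
      rw [ringChar.eq_zero]
      exact (CharP.ringChar_ne_zero_of_finite F).symm
    have h1 := jacobiSum_mul_jacobiSum_inv hchar hχ hψ hχψ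
    have h2 : jacobiSum χ⁻¹ ψ⁻¹ = (starRingEnd ℂ) (jacobiSum χ ψ) := by
      simp only [jacobiSum, map_sum, map_mul]
      refine Finset.sum_congr rfl fun z _ => ?_
      rw [← MulChar.star_apply', ← MulChar.star_apply', starRingEnd_apply, starRingEnd_apply]
    rw [h2, Complex.mul_conj, Complex.normSq_eq_norm_sq] at h1
    refine Real.le_sqrt_of_sq_le (le_of_eq ?_)
    exact_mod_cast h1

variable [DecidableEq F]

variable (F) in
/-- The pairs of units `(x, y)` on the line `1 + x + y = 0`. -/
def unitLine : Finset (Fˣ × Fˣ) := {p | (1 + p.1 + p.2 : F) = 0}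

theorem mem_unitLine {p : Fˣ × Fˣ} : p ∈ unitLine F ↔ (1 + p.1 + p.2 : F) = 0 := by
  simp [unitLine]

/-- Substitute `z = -x`, so that `1 - z = -y`. -/
theorem sum_unitLine (χ ψ : Fˣ →* ℂ) :
    ∑ p ∈ unitLine F, χ p.1 * ψ p.2 = χ (-1) * ψ (-1) *
      jacobiSum (MulChar.ofUnitHom χ.toHomUnits) (MulChar.ofUnitHom ψ.toHomUnits) := by
  rw [jacobiSum, Finset.mul_sum]
  refine Finset.sum_of_injOn (fun p => (-p.1 : F)) ?_ (by simp) ?_ ?_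
  · rintro ⟨x, y⟩ hp ⟨x', y'⟩ hp' h
    rw [Finset.mem_coe, mem_unitLine] at hp hp'
    have h1 : (x : F) = x' := neg_injective h
    have h2 : (y : F) = y' := by linear_combination hp - hp' - h1
    rw [Units.ext h1, Units.ext h2]
  · intro z _ hz
    by_cases hz0 : z = 0
    · rw [hz0, MulChar.map_zero, zero_mul, mul_zero]
    by_cases hz1 : 1 - z = 0
    · rw [hz1, MulChar.map_zero, mul_zero, mul_zero]
    refine absurd ⟨(-Units.mk0 z hz0, -Units.mk0 (1 - z) hz1), ?_, ?_⟩ hz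
    · rw [Finset.mem_coe, mem_unitLine]
      push_cast
      simp only [Units.val_mk0]
      ring
    · simp
  · rintro ⟨x, y⟩ hp
    rw [mem_unitLine] at hp
    have h1 : (-x : F) = ((-x : Fˣ) : F) := by simp
    have h2 : (1 - -x : F) = ((-y : Fˣ) : F) := by push_cast; linear_combination hp
    simp only [h2]
    rw [h1, MulChar.ofUnitHom_coe, MulChar.ofUnitHom_coe, MonoidHom.coe_toHomUnits,
      MonoidHom.coe_toHomUnits]
    have h3 : χ x = χ (-1) * χ (-x) := by rw [← map_mul]; simp
    have h4 : ψ y = ψ (-1) * ψ (-y) := by rw [← map_mul]; simp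
    rw [h3, h4]
    ring

theorem card_unitLine : ((unitLine F).card : ℂ) = Fintype.card F - 2 := by
  have h := sum_unitLine (F := F) 1 1
  rw [(ofUnitHom_toHomUnits_eq_one_iff 1).mpr rfl, jacobiSum_one_one] at h
  simpa using h

theorem norm_sum_unitLine_le {χ ψ : Fˣ →* ℂ} (h : χ ≠ 1 ∨ ψ ≠ 1) :
    ‖∑ p ∈ unitLine F, χ p.1 * ψ p.2‖ ≤ √(Fintype.card F) := by
  have hn (χ : Fˣ →* ℂ) : ‖χ (-1)‖ = 1 := by
    have h1 : χ (-1) * χ (-1) = 1 := by rw [← map_mul]; simp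
    rcases mul_self_eq_one_iff.mp h1 with h3 | h3 <;> rw [h3] <;> simp
  rw [sum_unitLine, norm_mul, norm_mul, hn, hn, one_mul, one_mul]
  refine norm_jacobiSum_le ?_
  rwa [Ne, Ne, ofUnitHom_toHomUnits_eq_one_iff, ofUnitHom_toHomUnits_eq_one_iff]

/-- Points of the line `1 + x + y = 0` are equidistributed among the fibres of a surjective
homomorphism from the torus to a finite abelian group. -/
theorem abs_card_unitLine_ker_sub_le {A : Type*} [AddCommGroup A] [Fintype A] [DecidableEq A]
    (f : Fˣ × Fˣ →* Multiplicative A) (hf : Function.Surjective f) :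
    |(((unitLine F).filter fun p => f p = 1).card : ℝ) -
      ((Fintype.card F : ℝ) - 2) / Fintype.card A| ≤ √(Fintype.card F) := by
  have hA : (0 : ℝ) < Fintype.card A := by exact_mod_cast Fintype.card_pos
  set S : AddChar A ℂ → ℂ := fun θ => ∑ p ∈ unitLine F, θ (Multiplicative.toAdd (f p)) with hS
  have h1 : ∑ θ, S θ = (Fintype.card A : ℂ) * ((unitLine F).filter fun p => f p = 1).card := by
    rw [hS, Finset.sum_comm]
    simp_rw [AddChar.sum_apply_eq_ite, toAdd_eq_zero]
    rw [← Finset.sum_filter, Finset.sum_const, nsmul_eq_mul, mul_comm]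
  have h0 : S 0 = (Fintype.card F : ℂ) - 2 := by
    rw [hS, ← card_unitLine]
    simp
  -- `θ ∘ f` splits as a product of characters in `x` and in `y`; by surjectivity of `f` they are
  -- not both trivial.
  have hb (θ : AddChar A ℂ) (hθ : θ ≠ 0) : ‖S θ‖ ≤ √(Fintype.card F) := by
    obtain ⟨τ, hτ⟩ : ∃ τ : Fˣ × Fˣ →* ℂ, ∀ p, τ p = θ (Multiplicative.toAdd (f p)) :=
      ⟨θ.toMonoidHom.comp f, fun _ => rfl⟩
    have h2 : S θ = ∑ p ∈ unitLine F, τ.comp (MonoidHom.inl Fˣ Fˣ) p.1 *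
        τ.comp (MonoidHom.inr Fˣ Fˣ) p.2 := by
      refine Finset.sum_congr rfl fun p _ => ?_
      rw [MonoidHom.comp_apply, MonoidHom.comp_apply, ← map_mul, MonoidHom.inl_apply,
        MonoidHom.inr_apply, Prod.mk_mul_mk, mul_one, one_mul, hτ]
    rw [h2]
    refine norm_sum_unitLine_le ?_
    by_contra! hc
    apply hθ
    ext a
    obtain ⟨p, hp⟩ := hf (Multiplicative.ofAdd a)
    have h3 : τ p = 1 := by
      have h4 : p = (p.1, 1) * (1, p.2) := by simp
      rw [h4, map_mul]
      have h5 := DFunLike.congr_fun hc.1 p.1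
      have h6 := DFunLike.congr_fun hc.2 p.2
      rw [MonoidHom.comp_apply, MonoidHom.inl_apply, MonoidHom.one_apply] at h5
      rw [MonoidHom.comp_apply, MonoidHom.inr_apply, MonoidHom.one_apply] at h6
      rw [h5, h6, one_mul]
    rw [AddChar.zero_apply, ← h3, hτ, hp, toAdd_ofAdd]
  have h2 : ‖∑ θ ∈ Finset.univ.erase (0 : AddChar A ℂ), S θ‖ ≤
      Fintype.card A * √(Fintype.card F) := by
    refine (norm_sum_le_of_le _ fun θ hθ => hb θ (Finset.ne_of_mem_erase hθ)).trans ?_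
    rw [Finset.sum_const, nsmul_eq_mul]
    refine mul_le_mul_of_nonneg_right ?_ (Real.sqrt_nonneg _)
    have := Finset.card_erase_le (s := Finset.univ) (a := (0 : AddChar A ℂ))
    rw [Finset.card_univ, AddChar.card_eq] at this
    exact_mod_cast this
  rw [← Finset.add_sum_erase _ _ (Finset.mem_univ (0 : AddChar A ℂ)), h0] at h1
  have h3 : ∑ θ ∈ Finset.univ.erase (0 : AddChar A ℂ), S θ =
      ((Fintype.card A * ((unitLine F).filter fun p => f p = 1).card -
        (Fintype.card F - 2) : ℝ) : ℂ) := by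
    push_cast
    linear_combination h1
  rw [h3, Complex.norm_real, Real.norm_eq_abs] at h2
  have h4 : (((unitLine F).filter fun p => f p = 1).card : ℝ) -
      ((Fintype.card F : ℝ) - 2) / Fintype.card A =
      (Fintype.card A * ((unitLine F).filter fun p => f p = 1).card -
        (Fintype.card F - 2) : ℝ) / Fintype.card A := by
    field_simp
  rw [h4, abs_div, abs_of_pos hA, div_le_iff₀ hA, mul_comm (√_)]
  exact h2

end LineCount

/-! ### Counting points with prescribed divisibility of logarithms. -/

section ResidueCount

variable {ℓ n : ℕ} [Fact ℓ.Prime] (e : (ZMod ℓ)ˣ ≃* Multiplicative (ZMod n))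

/-- Points of the line `1 + x + y = 0` whose discrete logarithms `a, b` satisfy `2 ^ α ∣ a`,
`2 ^ α ∣ b`, `3 ^ s ∣ a` and `3 ^ t ∣ a + b`. -/
def residueLine (α s t : ℕ) : Finset ((ZMod ℓ)ˣ × (ZMod ℓ)ˣ) :=
  (unitLine (ZMod ℓ)).filter fun p =>
    (2 ^ α ∣ discreteLog e p.1 ∧ 2 ^ α ∣ discreteLog e p.2) ∧
      3 ^ s ∣ discreteLog e p.1 ∧ 3 ^ t ∣ discreteLog e p.1 + discreteLog e p.2

theorem abs_card_residueLine_sub_le [NeZero n] {α β m s t : ℕ} (hn : n = 2 ^ α * 3 ^ β * m)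
    (hs : s ≤ β) (ht : t ≤ β) :
    |((residueLine e α s t).card : ℝ) - ((ℓ : ℝ) - 2) / (2 ^ α * 2 ^ α * (3 ^ s * 3 ^ t))| ≤
      √(ℓ : ℝ) := by
  have h2 : 2 ^ α ∣ n := ⟨3 ^ β * m, by rw [hn, mul_assoc]⟩
  have h3 {r : ℕ} (hr : r ≤ β) : 3 ^ r ∣ n :=
    (pow_dvd_pow 3 hr).trans ⟨2 ^ α * m, by rw [hn]; ring⟩
  let c2 := ZMod.castHom h2 (ZMod (2 ^ α))
  let cs := ZMod.castHom (h3 hs) (ZMod (3 ^ s))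
  let ct := ZMod.castHom (h3 ht) (ZMod (3 ^ t))
  let L : (ZMod ℓ)ˣ → ZMod n := fun x => Multiplicative.toAdd (e x)
  have hL (x y : (ZMod ℓ)ˣ) : L (x * y) = L x + L y := by
    simp only [L, map_mul, toAdd_mul]
  have hLd (x : (ZMod ℓ)ˣ) : ((discreteLog e x : ℕ) : ZMod n) = L x := ZMod.natCast_zmod_val _
  let f : (ZMod ℓ)ˣ × (ZMod ℓ)ˣ →*
      Multiplicative ((ZMod (2 ^ α) × ZMod (2 ^ α)) × (ZMod (3 ^ s) × ZMod (3 ^ t))) :=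
    MonoidHom.mk' (fun p => Multiplicative.ofAdd
      ((c2 (L p.1), c2 (L p.2)), (cs (L p.1), ct (L p.1 + L p.2)))) fun p q => by
      rw [← ofAdd_add]
      congr 1
      simp only [Prod.fst_mul, Prod.snd_mul, hL, map_add, Prod.mk_add_mk]
      rw [add_add_add_comm]
  -- Choose `a` by the Chinese remainder theorem, then `b` with residue `z - a` modulo `3^t`.
  have hf : Function.Surjective f := by
    intro z
    obtain ⟨⟨⟨u, v⟩, w, z⟩, rfl⟩ := Multiplicative.ofAdd.surjective z
    have hcop (r : ℕ) : Nat.Coprime (2 ^ α) (3 ^ r) := Nat.Coprime.pow _ _ (by norm_num)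
    obtain ⟨a, ha2, ha3⟩ := Nat.chineseRemainder (hcop s) u.val w.val
    obtain ⟨b, hb2, hb3⟩ := Nat.chineseRemainder (hcop t) v.val (z - a).val
    rw [← ZMod.natCast_eq_natCast_iff, ZMod.natCast_zmod_val] at ha2 ha3 hb2 hb3
    refine ⟨(e.symm (Multiplicative.ofAdd (a : ZMod n)),
      e.symm (Multiplicative.ofAdd (b : ZMod n))), ?_⟩
    simp only [f, L, MonoidHom.mk'_apply, MulEquiv.apply_symm_apply, toAdd_ofAdd, map_natCast,
      map_add, ha2, ha3, hb2, hb3, add_sub_cancel]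
  have hf1 (p : (ZMod ℓ)ˣ × (ZMod ℓ)ˣ) : f p = 1 ↔
      (2 ^ α ∣ discreteLog e p.1 ∧ 2 ^ α ∣ discreteLog e p.2) ∧
      3 ^ s ∣ discreteLog e p.1 ∧ 3 ^ t ∣ discreteLog e p.1 + discreteLog e p.2 := by
    simp only [f, MonoidHom.mk'_apply, ofAdd_eq_one, Prod.mk_eq_zero, ← hLd, ← Nat.cast_add,
      map_natCast, ZMod.natCast_eq_zero_iff]
  have h := abs_card_unitLine_ker_sub_le f hf
  simp only [hf1, Fintype.card_prod, ZMod.card] at h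
  push_cast at h
  exact h

theorem card_residueLine_sdiff (α s : ℕ) :
    (((unitLine (ZMod ℓ)).filter fun p =>
      (2 ^ α ∣ discreteLog e p.1 ∧ 2 ^ α ∣ discreteLog e p.2) ∧
        3 ^ s ∣ discreteLog e p.1 ∧ ¬ 3 ^ (s + 1) ∣ discreteLog e p.1 ∧
        3 ^ (s + 1) ∣ discreteLog e p.1 + discreteLog e p.2).card : ℝ) =
      (residueLine e α s (s + 1)).card - (residueLine e α (s + 1) (s + 1)).card := by
  have hsub : residueLine e α (s + 1) (s + 1) ⊆ residueLine e α s (s + 1) := by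
    refine Finset.monotone_filter_right _ fun p _ hp => ⟨hp.1, ?_, hp.2.2⟩
    exact (pow_dvd_pow 3 s.le_succ).trans hp.2.1
  rw [eq_sub_iff_add_eq, ← Finset.card_sdiff_add_card_eq_card hsub, Nat.cast_add]
  congr 3
  ext p
  simp only [residueLine, Finset.mem_sdiff, Finset.mem_filter]
  tauto

theorem card_exists_residueLine (α β : ℕ) :
    (((unitLine (ZMod ℓ)).filter fun p => ∃ s ∈ Finset.range β,
      (2 ^ α ∣ discreteLog e p.1 ∧ 2 ^ α ∣ discreteLog e p.2) ∧
        3 ^ s ∣ discreteLog e p.1 ∧ ¬ 3 ^ (s + 1) ∣ discreteLog e p.1 ∧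
        3 ^ (s + 1) ∣ discreteLog e p.1 + discreteLog e p.2).card : ℝ) =
      ∑ s ∈ Finset.range β,
        (((residueLine e α s (s + 1)).card : ℝ) - (residueLine e α (s + 1) (s + 1)).card) := by
  have h : ((unitLine (ZMod ℓ)).filter fun p => ∃ s ∈ Finset.range β,
      (2 ^ α ∣ discreteLog e p.1 ∧ 2 ^ α ∣ discreteLog e p.2) ∧
        3 ^ s ∣ discreteLog e p.1 ∧ ¬ 3 ^ (s + 1) ∣ discreteLog e p.1 ∧
        3 ^ (s + 1) ∣ discreteLog e p.1 + discreteLog e p.2) =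
      (Finset.range β).biUnion fun s => (unitLine (ZMod ℓ)).filter fun p =>
        (2 ^ α ∣ discreteLog e p.1 ∧ 2 ^ α ∣ discreteLog e p.2) ∧
        3 ^ s ∣ discreteLog e p.1 ∧ ¬ 3 ^ (s + 1) ∣ discreteLog e p.1 ∧
        3 ^ (s + 1) ∣ discreteLog e p.1 + discreteLog e p.2 := by
    ext p
    simp only [Finset.mem_filter, Finset.mem_biUnion]
    exact ⟨fun ⟨h, s, hs, h'⟩ => ⟨s, hs, h, h'⟩, fun ⟨s, hs, h, h'⟩ => ⟨h, s, hs, h'⟩⟩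
  rw [h, Finset.card_biUnion, Nat.cast_sum]
  · exact Finset.sum_congr rfl fun s _ => card_residueLine_sdiff e α s
  · have key (s t : ℕ) (hst : s < t) (p : (ZMod ℓ)ˣ × (ZMod ℓ)ˣ)
        (hs : ¬ 3 ^ (s + 1) ∣ discreteLog e p.1) (ht : 3 ^ t ∣ discreteLog e p.1) : False :=
      hs ((pow_dvd_pow 3 hst).trans ht)
    intro s _ t _ hst
    refine Finset.disjoint_left.mpr fun p hp hp' => ?_
    rw [Finset.mem_filter] at hp hp'
    rcases lt_or_gt_of_ne hst with h1 | h1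
    · exact key s t h1 p hp.2.2.2.1 hp'.2.2.1
    · exact key t s h1 p hp'.2.2.2.1 hp.2.2.1

/-- The summand is `4^(-α) · (2/9) · 9^(-s)`, a geometric progression. -/
theorem sum_index_density (α β : ℕ) :
    ∑ s ∈ Finset.range β, ((1 : ℝ) / (2 ^ α * 2 ^ α * (3 ^ s * 3 ^ (s + 1))) -
      1 / (2 ^ α * 2 ^ α * (3 ^ (s + 1) * 3 ^ (s + 1)))) =
      1 / 2 ^ (2 * α + 2) * (1 - 1 / 3 ^ (2 * β)) := by
  induction β with
  | zero => simp
  | succ β ih =>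
    rw [Finset.sum_range_succ, ih]
    field_simp
    ring

theorem abs_card_exists_residueLine_sub_le [NeZero n] {α β m : ℕ} (hn : n = 2 ^ α * 3 ^ β * m) :
    |(((unitLine (ZMod ℓ)).filter fun p => ∃ s ∈ Finset.range β,
      (2 ^ α ∣ discreteLog e p.1 ∧ 2 ^ α ∣ discreteLog e p.2) ∧
        3 ^ s ∣ discreteLog e p.1 ∧ ¬ 3 ^ (s + 1) ∣ discreteLog e p.1 ∧
        3 ^ (s + 1) ∣ discreteLog e p.1 + discreteLog e p.2).card : ℝ) -
      1 / 2 ^ (2 * α + 2) * (1 - 1 / 3 ^ (2 * β)) * ((ℓ : ℝ) - 2)| ≤ 2 * β * √(ℓ : ℝ) := by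
  rw [card_exists_residueLine, ← sum_index_density, Finset.sum_mul, ← Finset.sum_sub_distrib]
  refine (Finset.abs_sum_le_sum_abs _ _).trans ?_
  have h : ∀ s ∈ Finset.range β,
      |((residueLine e α s (s + 1)).card : ℝ) - (residueLine e α (s + 1) (s + 1)).card -
        ((1 : ℝ) / (2 ^ α * 2 ^ α * (3 ^ s * 3 ^ (s + 1))) -
          1 / (2 ^ α * 2 ^ α * (3 ^ (s + 1) * 3 ^ (s + 1)))) * ((ℓ : ℝ) - 2)| ≤ 2 * √(ℓ : ℝ) := by
    intro s hs
    have hs' : s + 1 ≤ β := Finset.mem_range.mp hs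
    have h1 := abs_card_residueLine_sub_le e hn (s.le_succ.trans hs') hs'
    have h2 := abs_card_residueLine_sub_le e hn hs' hs'
    have h3 := (abs_sub _ _).trans (add_le_add h1 h2)
    rw [← two_mul] at h3
    refine le_trans (le_of_eq ?_) h3
    congr 1
    ring
  refine (Finset.sum_le_sum h).trans (le_of_eq ?_)
  rw [Finset.sum_const, Finset.card_range, nsmul_eq_mul]
  ring

end ResidueCount

/-! ### From points on the line to `K`, and the final estimate. -/

namespace Demjanenko

theorem card_K_eq {ℓ : ℕ} [Fact ℓ.Prime] (hℓ2 : ℓ ≠ 2)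
    (P : (ZMod ℓ)ˣ × (ZMod ℓ)ˣ → Prop) [DecidablePred P]
    (hP : ∀ p, P p ↔ ∃ χ : (ZMod ℓ)ˣ →* ℂ, χ (-1) = -1 ∧ 1 + χ p.1 + χ p.2 = 0) :
    (K ℓ).card = (((unitLine (ZMod ℓ)).filter P).filter fun p => p.1 * p.1 ≠ p.2).card := by
  classical
  symm
  refine Finset.card_bij (fun p _ => (p.1 : ZMod ℓ).val) ?_ ?_ ?_
  · rintro ⟨x, y⟩ hp
    rw [Finset.mem_filter, Finset.mem_filter, mem_unitLine, hP] at hp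
    obtain ⟨⟨hxy, hχ⟩, hne⟩ := hp
    have hx : (x : ZMod ℓ) = ((x : ZMod ℓ).val : ℕ) := (ZMod.natCast_zmod_val _).symm
    rw [K, Finset.mem_filter, Finset.mem_Icc]
    refine ⟨⟨units_val_pos x, ?_⟩, (det_D_eq_zero_iff_of_sq_ne hx hxy hne hℓ2).mpr hχ⟩
    -- The value `ℓ - 1` would mean `x = -1`, hence `y = 0`; this is why `k` stops at `ℓ - 2`.
    have h1 := ZMod.val_lt (x : ZMod ℓ)
    have h2 : (x : ZMod ℓ).val ≠ ℓ - 1 := by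
      intro h
      rw [h, Nat.cast_sub (Fact.out : ℓ.Prime).one_le, ZMod.natCast_self, Nat.cast_one,
        zero_sub] at hx
      refine y.ne_zero ?_
      linear_combination hxy - hx
    change (x : ZMod ℓ).val ≤ ℓ - 2
    omega
  · rintro ⟨x, y⟩ hp ⟨x', y'⟩ hp' h
    simp only [Finset.mem_filter, mem_unitLine] at hp hp'
    have h1 : (x : ZMod ℓ) = x' := ZMod.val_injective ℓ h
    have h2 : (y : ZMod ℓ) = y' := by linear_combination hp.1.1 - hp'.1.1 - h1
    rw [Units.ext h1, Units.ext h2]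
  · intro k hk
    rw [K, Finset.mem_filter, Finset.mem_Icc] at hk
    obtain ⟨⟨hk1, hk2⟩, hdet⟩ := hk
    have hx0 : (k : ZMod ℓ) ≠ 0 := by
      rw [Ne, ZMod.natCast_eq_zero_iff]
      exact fun h => by have := Nat.le_of_dvd hk1 h; omega
    have hy0 : (-((k + 1 : ℕ) : ZMod ℓ)) ≠ 0 := by
      rw [neg_ne_zero, Ne, ZMod.natCast_eq_zero_iff]
      exact fun h => by have := Nat.le_of_dvd k.succ_pos h; omega
    have hx : ((Units.mk0 _ hx0 : (ZMod ℓ)ˣ) : ZMod ℓ) = k := Units.val_mk0 _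
    have hxy : (1 + (Units.mk0 _ hx0 : (ZMod ℓ)ˣ) + (Units.mk0 _ hy0 : (ZMod ℓ)ˣ) : ZMod ℓ) = 0 :=
        by
      rw [Units.val_mk0, Units.val_mk0]
      push_cast
      ring
    have hne : (Units.mk0 _ hx0 * Units.mk0 _ hx0 : (ZMod ℓ)ˣ) ≠ Units.mk0 _ hy0 :=
      fun h => det_D_ne_zero_of_sq_eq hx hxy h hdet
    refine ⟨(Units.mk0 _ hx0, Units.mk0 _ hy0), ?_, ?_⟩
    · rw [Finset.mem_filter, Finset.mem_filter, mem_unitLine, hP]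
      exact ⟨⟨hxy, (det_D_eq_zero_iff_of_sq_ne hx hxy hne hℓ2).mp hdet⟩, hne⟩
    · rw [hx, ZMod.val_natCast, Nat.mod_eq_of_lt]
      omega

/-- The first coordinates are roots of `X² + X + 1`, whose roots are `r` and `-1 - r`. -/
theorem card_unitLine_sq_eq_le {F : Type*} [Field F] [Fintype F] [DecidableEq F]
    (S : Finset (Fˣ × Fˣ)) (hS : ∀ p ∈ S, (1 + p.1 + p.2 : F) = 0 ∧ p.1 * p.1 = p.2) :
    S.card ≤ 2 := by
  rcases S.eq_empty_or_nonempty with rfl | ⟨⟨r, r'⟩, hr⟩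
  · simp
  have hroot {p : Fˣ × Fˣ} (hp : p ∈ S) : (1 + p.1 + p.1 * p.1 : F) = 0 := by
    have h := hS p hp
    rw [← Units.val_mul, h.2]
    exact h.1
  refine (Finset.card_le_card_of_injOn (t := {(r : F), -1 - (r : F)}) (fun p => (p.1 : F))
    ?_ ?_).trans Finset.card_le_two
  · intro p hp
    have h : ((p.1 : F) - r) * (p.1 + r + 1) = 0 := by
      linear_combination hroot hp - hroot hr
    rw [Finset.mem_coe, Finset.mem_insert, Finset.mem_singleton]
    rcases mul_eq_zero.mp h with h1 | h1
    · left; linear_combination h1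
    · right; linear_combination h1
  · intro p hp q hq h
    have h1 : p.1 = q.1 := Units.ext h
    exact Prod.ext h1 (by rw [← (hS p hp).2, ← (hS q hq).2, h1])

end Demjanenko

theorem theorem1 (ℓ : ℕ) [Fact ℓ.Prime] (α β m : ℕ) (hα : 0 < α)
    (hm : Nat.gcd m 6 = 1) (hℓ : ℓ - 1 = 2 ^ α * 3 ^ β * m) :
    |((Demjanenko.K ℓ).card : ℝ) - 1 / 2 ^ (2 * α + 2) * (1 - 1 / 3 ^ (2 * β)) * (ℓ : ℝ)|
      ≤ 4 * (β : ℝ) ^ 2 * Real.sqrt (ℓ : ℝ) + 33 / 16 := by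
  classical
  have hprime : ℓ.Prime := Fact.out
  have hℓ2 : ℓ ≠ 2 := by
    rintro rfl
    have h : 2 ∣ 1 := by
      rw [show (1 : ℕ) = 2 ^ α * 3 ^ β * m from hℓ, mul_assoc]
      exact Dvd.dvd.mul_right (dvd_pow_self 2 hα.ne') _
    norm_num at h
  have : NeZero (ℓ - 1) := ⟨by have := hprime.two_le; omega⟩
  have hcard : Nat.card (ZMod ℓ)ˣ = ℓ - 1 := by
    rw [Nat.card_eq_fintype_card, ZMod.card_units]
  have e : (ZMod ℓ)ˣ ≃* Multiplicative (ZMod (ℓ - 1)) :=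
    (hcard ▸ zmodCyclicMulEquiv (inferInstance : IsCyclic (ZMod ℓ)ˣ)).symm
  have hε : (-1 : (ZMod ℓ)ˣ) * -1 = 1 := by simp
  have hε1 : (-1 : (ZMod ℓ)ˣ) ≠ 1 := by
    intro h
    have h1 := congrArg Units.val h
    push_cast at h1
    have : Fact (2 < ℓ) := ⟨lt_of_le_of_ne hprime.two_le hℓ2.symm⟩
    exact ZMod.neg_one_ne_one h1
  set P : (ZMod ℓ)ˣ × (ZMod ℓ)ˣ → Prop := fun p => ∃ s ∈ Finset.range β,
      (2 ^ α ∣ discreteLog e p.1 ∧ 2 ^ α ∣ discreteLog e p.2) ∧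
        3 ^ s ∣ discreteLog e p.1 ∧ ¬ 3 ^ (s + 1) ∣ discreteLog e p.1 ∧
        3 ^ (s + 1) ∣ discreteLog e p.1 + discreteLog e p.2 with hP
  have hK := Demjanenko.card_K_eq hℓ2 P fun p =>
    (exists_odd_char_iff e hα hm hℓ hε hε1 p.1 p.2).symm
  have hS : |(((unitLine (ZMod ℓ)).filter P).card : ℝ) -
      1 / 2 ^ (2 * α + 2) * (1 - 1 / 3 ^ (2 * β)) * ((ℓ : ℝ) - 2)| ≤ 2 * β * √(ℓ : ℝ) := by
    convert abs_card_exists_residueLine_sub_le e hℓ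
  have hsplit := Finset.card_filter_add_card_filter_not (s := (unitLine (ZMod ℓ)).filter P)
    (fun p => p.1 * p.1 ≠ p.2)
  have hexc := Demjanenko.card_unitLine_sq_eq_le
    (((unitLine (ZMod ℓ)).filter P).filter fun p => ¬ p.1 * p.1 ≠ p.2) (by
      intro p hp
      rw [Finset.mem_filter, Finset.mem_filter, mem_unitLine, not_not] at hp
      exact ⟨hp.1.1, hp.2⟩)
  rw [← hK] at hsplit
  have hlow : (((unitLine (ZMod ℓ)).filter P).card : ℝ) ≤ (Demjanenko.K ℓ).card + 2 := by
    exact_mod_cast (by omega :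
      ((unitLine (ZMod ℓ)).filter P).card ≤ (Demjanenko.K ℓ).card + 2)
  have hup : ((Demjanenko.K ℓ).card : ℝ) ≤ ((unitLine (ZMod ℓ)).filter P).card := by
    exact_mod_cast (by omega : (Demjanenko.K ℓ).card ≤ ((unitLine (ZMod ℓ)).filter P).card)
  have hsqrt : 1 ≤ √(ℓ : ℝ) := by
    rw [Real.one_le_sqrt]
    exact_mod_cast hprime.one_le
  -- For `β = 0` there is no `s` and `K` is empty. For `β ≥ 1` the error `2β√ℓ` and the at most two
  -- exceptional points fit into `4β²√ℓ`, while replacing `ℓ - 2` by `ℓ` costs `2c ≤ 2 ≤ 33/16`.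
  rcases Nat.eq_zero_or_pos β with hβ | hβ
  · subst hβ
    have h0 : (((unitLine (ZMod ℓ)).filter P).card : ℝ) = 0 := by simp [hP]
    have h1 : ((Demjanenko.K ℓ).card : ℝ) = 0 := le_antisymm (h0 ▸ hup) (Nat.cast_nonneg _)
    rw [h1]
    norm_num
  · have hβ' : (1 : ℝ) ≤ β := by exact_mod_cast hβ
    set c : ℝ := 1 / 2 ^ (2 * α + 2) * (1 - 1 / 3 ^ (2 * β)) with hc
    have h3 : (1 : ℝ) / 3 ^ (2 * β) ≤ 1 := by
      rw [div_le_one (by positivity)]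
      exact one_le_pow₀ (by norm_num)
    have h3' : (0 : ℝ) ≤ 1 / 3 ^ (2 * β) := by positivity
    have h2 : (1 : ℝ) / 2 ^ (2 * α + 2) ≤ 1 := by
      rw [div_le_one (by positivity)]
      exact one_le_pow₀ (by norm_num)
    have h2' : (0 : ℝ) ≤ 1 / 2 ^ (2 * α + 2) := by positivity
    have hc0 : 0 ≤ c := mul_nonneg h2' (by linarith)
    have hc1 : c ≤ 1 := mul_le_one₀ h2 (by linarith) (by linarith)
    have hslack : 2 * β * √(ℓ : ℝ) + 2 ≤ 4 * (β : ℝ) ^ 2 * √(ℓ : ℝ) := by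
      nlinarith [mul_nonneg (sub_nonneg.mpr hβ') (sub_nonneg.mpr hsqrt),
        mul_nonneg (mul_nonneg (sub_nonneg.mpr hβ') (sub_nonneg.mpr hβ'))
          (Real.sqrt_nonneg (ℓ : ℝ)), mul_nonneg (sub_nonneg.mpr hβ') (Real.sqrt_nonneg (ℓ : ℝ))]
    rw [abs_le] at hS ⊢
    constructor <;> linarith [hS.1, hS.2]
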